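/- **Theorem 5.4.** Let $\Bbbk$ be an algebraically closed field of characteristic $p>0$. For a free abelian group $M$ of finite rank and a non-empty finite subset $A\subset M$, let $X_A\subset\mathbb P^{\#A-1}$ be the Zariski closure of the image of the torus $T_M=\operatorname{Spec}\Bbbk[M]$ under $t\mapsto[z^{u}(t)]_{u\in A}$, and let $\operatorname{Aff}(A)=\{\sum_i a_iu_i : a_i\in\mathbb Z,\ \sum_i a_i=1,\ u_i\in A\}$. The Gauss map $\gamma$ of an $n$-dimensional projective variety $X\subset\mathbb P^N$ is the rational map $X\dashrightarrow\mathbb G(n,\mathbb P^N)$ that sends each smooth point $x$ to the embedded tangent space $\mathbb T_xX$. Its rank is the rank of its differential $d_x\gamma$ at a general point $x\in X$. Two projective varieties $X_1\subset\mathbb P^{N_1}$, $X_2\subset\mathbb P^{N_2}$ are projectively equivalent if there are linear embeddings $\jmath_i:\mathbb P^{N_i}\hookrightarrow\mathbb P^{m}$ with $\jmath_1(X_1)=\jmath_2(X_2)$. Let $A'$ be a finite subset of a free abelian group $M'$ of finite rank with $\operatorname{Aff}(A')=M'$. Let $r,c>0$ be integers such that $(p,r)\neq(2,1)$ and $c$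 is coprime to $p$. Let $n,N$ be positive integers with $$n\ \ge\ \max\{(\#A'-1)+r,\ \operatorname{rk}(M')+r+1\}$$ and $$N\ \ge\ \begin{cases}2n-\operatorname{rk}(M')-r+1 & \text{if } p\ge 3,\ \text{or } p=2 \text{ and } r \text{ is even},\\ 2n-\operatorname{rk}(M')-r+2 & \text{if } p=2 \text{ and } r \text{ is odd}.\end{cases}$$ Then there exists a finite subset $A\subset\mathbb Z^n$ with $\operatorname{Aff}(A)=\mathbb Z^n$ and $\#A=N+1$ such that the Gauss map $\gamma$ of $X_A\subset\mathbb P^N$ satisfies the following conditions, where fibers are taken with the reduced structure: (i) the closure of each irreducible component of a general fiber of $\gamma$ is projectively equivalent to $X_{A'}$; (ii) the rank of $\gamma$ is equal to $r$; (iii) the number of irreducible components of a general fiber of $\gamma$ is equal to $c$. -/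

import Mathlib

open scoped LinearAlgebra.Projectivization

namespace ToricGauss

noncomputable section

/-! Projective varieties over an algebraically closed field `k` are treated classically, as Zariski
closed sets of `k`-points of the projective space `ℙ k (ι → k)` with homogeneous coordinates indexed
by a finite type `ι` (so of dimension `#ι - 1`). -/

/-- The Zariski topology on projective space: it is generated by the sets where one homogeneous
polynomial does not vanish. -/
instance zariskiTopology {k : Type*} [Field k] {ι : Type*} [Fintype ι] :
    TopologicalSpace (ℙ k (ι → k)) :=
  TopologicalSpace.generateFrom
    {U | ∃ (d : ℕ) (F : MvPolynomial ι k), F.IsHomogeneous d ∧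
      U = {x | MvPolynomial.eval x.rep F ≠ 0}}

section Varieties

variable {k : Type*} [Field k] {ι : Type*} [Fintype ι]

/-- The homogeneous polynomials vanishing on `X`. -/
def vanishingForms (X : Set (ℙ k (ι → k))) : Set (MvPolynomial ι k) :=
  {F | (∃ d : ℕ, F.IsHomogeneous d) ∧ ∀ x ∈ X, MvPolynomial.eval x.rep F = 0}

/-- The homogeneous ideal `I(X)`. -/
def vanishingIdeal (X : Set (ℙ k (ι → k))) : Ideal (MvPolynomial ι k) :=
  Ideal.span (vanishingForms X)

/-- The dimension of a projective variety `X`: the transcendence degree over `k` of the homogeneous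
coordinate ring `k[ι] / I(X)` (which is the dimension of the affine cone over `X`), minus one. -/
def dim (X : Set (ℙ k (ι → k))) : ℕ :=
  Cardinal.toNat (Algebra.trdeg k (MvPolynomial ι k ⧸ vanishingIdeal X)) - 1

/-- The differential `w ↦ ∑ i, (∂F/∂X_i)(v) * w i` of a polynomial `F` at the vector `v`. -/
def polyDifferential (F : MvPolynomial ι k) (v : ι → k) : (ι → k) →ₗ[k] k :=
  ∑ i, MvPolynomial.eval v (MvPolynomial.pderiv i F) • LinearMap.proj i

/-- The linear subspace of `k^ι` whose projectivization is the embedded tangent space `𝕋_x X`, for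
`x ∈ X`. -/
def embTangent (X : Set (ℙ k (ι → k))) (x : ℙ k (ι → k)) : Submodule k (ι → k) :=
  ⨅ F ∈ vanishingForms X, LinearMap.ker (polyDifferential F x.rep)

/-- The set of smooth points of `X`: those at which the embedded tangent space has dimension
`dim X` (as a projective linear subvariety). -/
def smoothLocus (X : Set (ℙ k (ι → k))) : Set (ℙ k (ι → k)) :=
  {x | x ∈ X ∧ Module.finrank k (embTangent X x) = dim X + 1}

/-- `Grassmannian k ι d` is the Grassmannian of `d`-dimensional linear subspaces of `k^ι`, that is
`𝔾(d - 1, ℙ k (ι → k))`. -/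
def Grassmannian (k : Type*) [Field k] (ι : Type*) (d : ℕ) : Type _ :=
  {L : Submodule k (ι → k) // Module.finrank k L = d}

/-- The Gauss map `γ : X ⇢ 𝔾(dim X, ℙ)`, which sends each smooth point `x` of `X` to `𝕋_x X`. -/
def gaussMap (X : Set (ℙ k (ι → k))) (x : smoothLocus X) : Grassmannian k ι (dim X + 1) :=
  ⟨embTangent X x.1, x.2.2⟩

/-- The fiber of the Gauss map of `X` through a smooth point `x`, as a set of points. -/
def gaussFiber (X : Set (ℙ k (ι → k))) (x : smoothLocus X) : Set (ℙ k (ι → k)) :=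
  Subtype.val '' (gaussMap X ⁻¹' {gaussMap X x})

/-- A property of smooth points of a variety `X` holds at a general point of `X`: there is a dense
open subset of `X` that consists of smooth points with the property. -/
def ForGeneralPoint (X : Set (ℙ k (ι → k))) (P : smoothLocus X → Prop) : Prop :=
  ∃ U : Set (ℙ k (ι → k)), IsOpen U ∧ X ⊆ closure (X ∩ U) ∧
    ∀ x ∈ X ∩ U, ∃ hx : x ∈ smoothLocus X, P ⟨x, hx⟩

/-- The maximal minors of the matrix with rows `b 0, …, b (d - 1)`. All `d`-tuples of columns are
listed, not only the increasing ones; so each Plücker coordinate occurs several times, up to sign,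
together with zeros. -/
def pluckerVector {d : ℕ} (b : Fin d → ι → k) : (Fin d → ι) → k :=
  fun I => Matrix.det (Matrix.of fun i j => b i (I j))

/-- Some maximal minor of a matrix with linearly independent rows is nonzero. -/
theorem pluckerVector_ne_zero {d : ℕ} (b : Fin d → ι → k) (hb : LinearIndependent k b) :
    pluckerVector b ≠ 0 := by
  classical
  intro h0
  obtain ⟨g, hg⟩ := (Fintype.linearCombination k b).exists_leftInverse_of_injective
    (LinearMap.ker_eq_bot.2 hb.fintypeLinearCombination_injective)
  have hgb : ∀ l, g (b l) = Pi.single l 1 := by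
    intro l
    have := LinearMap.congr_fun hg (Pi.single l 1)
    simpa [Fintype.linearCombination_apply_single] using this
  have hrow : (fun i => ∑ j, g (Pi.single j 1) i • fun l => b l j) =
      (1 : Matrix (Fin d) (Fin d) k) := by
    ext i l
    have hl : g (b l) i = ∑ j, b l j * g (Pi.single j 1) i := by
      conv_lhs => rw [pi_eq_sum_univ' (b l)]
      rw [map_sum, Finset.sum_apply]
      refine Finset.sum_congr rfl fun j _ => ?_
      rw [map_smul]
      rfl
    rw [hgb l] at hl
    rw [Finset.sum_apply, Matrix.one_apply]
    simpa [Pi.single_apply, mul_comm] using hl.symm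
  have h1 : Matrix.detRowAlternating (1 : Matrix (Fin d) (Fin d) k) = 0 := by
    rw [← hrow, ← AlternatingMap.coe_multilinearMap, MultilinearMap.map_sum]
    refine Finset.sum_eq_zero fun I _ => ?_
    rw [MultilinearMap.map_smul_univ]
    have h2 : Matrix.det (Matrix.of fun i j => b i (I j)) = 0 := congrFun h0 I
    rw [← Matrix.det_transpose] at h2
    have h3 : (Matrix.detRowAlternating (n := Fin d) (R := k)).toMultilinearMap
        (fun i l => b l (I i)) = 0 := h2
    exact (congrArg _ h3).trans (smul_zero _)
  exact one_ne_zero ((Matrix.det_one (n := Fin d) (R := k)).symm.trans h1)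

/-- The Plücker embedding of the Grassmannian in projective space. The point does not depend on the
basis that is chosen. -/
def plucker {d : ℕ} (L : Grassmannian k ι d) : ℙ k ((Fin d → ι) → k) :=
  Projectivization.mk k
    (pluckerVector fun i => ((Module.finBasisOfFinrankEq k L.1 L.2 i : L.1) : ι → k))
    (pluckerVector_ne_zero _
      ((Module.finBasisOfFinrankEq k L.1 L.2).linearIndependent.map' L.1.subtype
        L.1.ker_subtype))

variable {κ : Type*}

/-- The map `f` from the smooth points of `X` to a projective space is represented, in a
neighbourhood of the point `x`, by the homogeneous polynomials `G` of the same degree `d`. -/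
def IsRepresentedNear (X : Set (ℙ k (ι → k))) (f : smoothLocus X → ℙ k (κ → k))
    (x : smoothLocus X) (d : ℕ) (G : κ → MvPolynomial ι k) : Prop :=
  (∀ j, (G j).IsHomogeneous d) ∧
    ∃ U : Set (ℙ k (ι → k)), IsOpen U ∧ x.1 ∈ U ∧
      ∀ y : smoothLocus X, y.1 ∈ U →
        ∃ h : (fun j => MvPolynomial.eval y.1.rep (G j)) ≠ 0,
          f y = Projectivization.mk k (fun j => MvPolynomial.eval y.1.rep (G j)) h

/-- The differential at `x` of the map `[v] ↦ [G v]` on `X`. Let `v` represent `x`. The Zariski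
tangent space of `X` at `x` is `embTangent X x` modulo the line of `v`, that of the projective space
at `[G v]` is `k^κ` modulo the line of `G v`, and `w` is sent to the class of the derivative of `G`
at `v` in the direction `w` (by Euler's formula `v` itself is sent to zero, so that leaving out the
quotient of the source does not change the rank). -/
def differential (X : Set (ℙ k (ι → k))) (x : ℙ k (ι → k)) (G : κ → MvPolynomial ι k) :
    embTangent X x →ₗ[k]
      ((κ → k) ⧸ Submodule.span k {(fun j => MvPolynomial.eval x.rep (G j) : κ → k)}) :=
  (Submodule.mkQ _).comp
    ((LinearMap.pi fun j => polyDifferential (G j) x.rep).comp (embTangent X x).subtype)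

/-- The differential `d_x f` exists (`f` is regular at `x`) and its rank is `r`. The rank does not
depend on the local representation of `f`. -/
def RankAtEq (X : Set (ℙ k (ι → k))) (f : smoothLocus X → ℙ k (κ → k)) (x : smoothLocus X)
    (r : ℕ) : Prop :=
  ∃ (d : ℕ) (G : κ → MvPolynomial ι k), IsRepresentedNear X f x d G ∧
    Module.finrank k (LinearMap.range (differential X x.1 G)) = r

/-- The rank of the Gauss map of `X`, i.e. the rank of its differential at a general point, is `r`.
The Grassmannian is embedded by the Plücker embedding. -/
def GaussRankEq (X : Set (ℙ k (ι → k))) (r : ℕ) : Prop :=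
  ForGeneralPoint X fun x => RankAtEq X (fun y => plucker (gaussMap X y)) x r

/-- `X` and `Y` are projectively equivalent: they become equal after linear embeddings of the
ambient projective spaces in a common projective space. -/
def ProjEquiv {ι₁ ι₂ : Type*} (X : Set (ℙ k (ι₁ → k))) (Y : Set (ℙ k (ι₂ → k))) : Prop :=
  ∃ (m : ℕ) (f : (ι₁ → k) →ₗ[k] (Fin (m + 1) → k)) (g : (ι₂ → k) →ₗ[k] (Fin (m + 1) → k))
    (hf : Function.Injective f) (hg : Function.Injective g),
      Projectivization.map f hf '' X = Projectivization.map g hg '' Y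

end Varieties

/-- The toric variety `X_A ⊆ ℙ k (A → k)` of a finite subset `A` of a free abelian group `M`: the
Zariski closure of the set of the points `[z^u(t)]_{u ∈ A}`, where `t` runs through the torus
`T_M = Hom(M, kˣ)`. -/
def toricVariety (k : Type*) [Field k] {M : Type*} [AddCommGroup M] (A : Finset M) :
    Set (ℙ k (A → k)) :=
  closure {x | ∃ (t : Multiplicative M →* kˣ)
    (h : (fun u : A => (t (Multiplicative.ofAdd (u : M)) : k)) ≠ 0),
      x = Projectivization.mk k (fun u : A => (t (Multiplicative.ofAdd (u : M)) : k)) h}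

end

end ToricGauss

/-! Write the weights of `A` in barycentric coordinates `a u` with respect to an affine basis `v i`
of the lattice contained in `A`. At a torus point `x` of `X_A` the tangent space consists of the
vectors `(x_u f(u))`, where `f` runs through the affine functions with values in `k`. So a torus
point `y` has the same tangent space exactly when multiplication by `y/x` preserves affine
functions. This means that `y/x` agrees at `u` and `v i` whenever `a u i` is nonzero in `k`
(`IsAffineFrame.edgeInvariant_iff`). The differences `a u - v i` along these edges span
`edgeLattice`, whose equations govern the fiber. Since `p`-th powers are injective on `k`, an `m`
with `p • m` in this lattice gives the same equation. Smooth points outside the torus may also lie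
in the fiber; `IsAffineFrame.vpow_eq_of_mem_edgeLattice` shows that they satisfy the same binomial
equations, hence lie in the closure of the torus part.

In Plücker coordinates the Gauss map is monomial, and the kernel of its differential is the space of
edge invariant affine functions, so the rank is the codimension of that space
(`IsAffineFrame.gaussRankEq`).

It remains to choose weights (`toricWeights`). The frame has `r + q = n + 1` elements, and `σ` maps
the last `q` of them onto `A'`. Extra weights, one or two of them, tie the first `r` frame elements
to a chosen one `o` of the others. This lowers the dimension of the edge invariant functions to `q`,
so that the rank is `r`. Finally one adds translates of a frame element `l` by `p μ_j`. Modulo `p`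
they are invisible, so they do not affect the rank, but they put `p μ_j` in the edge lattice. The
`μ_j` generate the relations between the `σ j` on which a primitive functional `δ` is divisible by
`c`. The relations make each component a torus orbit with weights `A'`, and the index `c` splits the
fiber according to the `c`-th roots of unity, of which there are `c` because `c` is prime to `p`. -/

set_option linter.unusedSectionVars false

namespace ToricGauss

open MvPolynomial

/-! ### Zariski closures and linear embeddings. -/

section Zariski

variable {k : Type*} [Field k] {ι : Type*} [Fintype ι]

theorem eval_smul_of_isHomogeneous {F : MvPolynomial ι k} {d : ℕ} (hF : F.IsHomogeneous d)
    (c : k) (v : ι → k) : eval (c • v) F = c ^ d * eval v F := by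
  rw [eval_eq', eval_eq', Finset.mul_sum]
  refine Finset.sum_congr rfl fun α hα => ?_
  have hd : ∑ i, α i = d := by
    rw [hF.degree_eq_sum_deg_support hα]
    exact (Finset.sum_subset (Finset.subset_univ _) (by simp)).symm
  simp only [Pi.smul_apply, smul_eq_mul, mul_pow, Finset.prod_mul_distrib, Finset.prod_pow_eq_pow_sum,
    hd]
  ring

theorem eval_rep_mk_eq_zero_iff {F : MvPolynomial ι k} {d : ℕ} (hF : F.IsHomogeneous d)
    (v : ι → k) (hv : v ≠ 0) :
    eval (Projectivization.mk k v hv).rep F = 0 ↔ eval v F = 0 := by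
  obtain ⟨a, ha⟩ := Projectivization.exists_smul_eq_mk_rep k v hv
  rw [← ha, Units.smul_def, eval_smul_of_isHomogeneous hF]
  simp

theorem isOpen_eval_ne_zero {F : MvPolynomial ι k} {d : ℕ} (hF : F.IsHomogeneous d) :
    IsOpen {x : ℙ k (ι → k) | eval x.rep F ≠ 0} :=
  TopologicalSpace.isOpen_generateFrom_of_mem ⟨d, F, hF, rfl⟩

theorem isClosed_eval_eq_zero {F : MvPolynomial ι k} {d : ℕ} (hF : F.IsHomogeneous d) :
    IsClosed {x : ℙ k (ι → k) | eval x.rep F = 0} := by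
  rw [← isOpen_compl_iff]
  exact isOpen_eval_ne_zero hF

/-- Every neighbourhood contains a basic open set, the nonvanishing set of a single form. -/
theorem exists_form_of_isOpen {U : Set (ℙ k (ι → k))} (hU : IsOpen U) {y : ℙ k (ι → k)}
    (hy : y ∈ U) : ∃ (d : ℕ) (F : MvPolynomial ι k), F.IsHomogeneous d ∧ eval y.rep F ≠ 0 ∧
      {x : ℙ k (ι → k) | eval x.rep F ≠ 0} ⊆ U := by
  induction hU with
  | basic s hs =>
    obtain ⟨d, F, hF, rfl⟩ := hs
    exact ⟨d, F, hF, hy, subset_rfl⟩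
  | univ => exact ⟨0, 1, isHomogeneous_one _ _, by simp, Set.subset_univ _⟩
  | inter s t _ _ hs ht =>
    obtain ⟨d, F, hF, hFy, hFs⟩ := hs hy.1
    obtain ⟨e, G, hG, hGy, hGt⟩ := ht hy.2
    refine ⟨d + e, F * G, hF.mul hG, by simp [hFy, hGy], fun x hx => ?_⟩
    have hx' : eval x.rep (F * G) ≠ 0 := hx
    rw [map_mul] at hx'
    exact ⟨hFs (left_ne_zero_of_mul hx'), hGt (right_ne_zero_of_mul hx')⟩
  | sUnion S _ h =>
    obtain ⟨s, hs, hys⟩ := hy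
    obtain ⟨d, F, hF, hFy, hFs⟩ := h s hs hys
    exact ⟨d, F, hF, hFy, hFs.trans (Set.subset_sUnion_of_mem hs)⟩

/-- The nonvanishing sets of single forms are a basis of the topology, not only a subbasis, so a
point outside the closure is separated from `S` by one form. -/
theorem mem_closure_iff_forms {S : Set (ℙ k (ι → k))} {y : ℙ k (ι → k)} :
    y ∈ closure S ↔ ∀ F ∈ vanishingForms S, eval y.rep F = 0 := by
  constructor
  · rintro hy F ⟨⟨d, hF⟩, hFS⟩
    have hS : S ⊆ {x | eval x.rep F = 0} := fun x hx => hFS x hx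
    have h := closure_minimal hS (isClosed_eval_eq_zero hF) hy
    exact h
  · intro h
    rw [mem_closure_iff]
    intro U hU hyU
    obtain ⟨d, F, hF, hFy, hFU⟩ := exists_form_of_isOpen hU hyU
    by_contra hne
    refine hFy (h F ⟨⟨d, hF⟩, fun x hx => ?_⟩)
    by_contra hx0
    exact hne ⟨x, hFU hx0, hx⟩

theorem vanishingForms_closure (S : Set (ℙ k (ι → k))) :
    vanishingForms (closure S) = vanishingForms S := by
  ext F
  constructor
  · rintro ⟨hF, h⟩
    exact ⟨hF, fun x hx => h x (subset_closure hx)⟩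
  · rintro ⟨hF, h⟩
    exact ⟨hF, fun x hx => mem_closure_iff_forms.1 hx F ⟨hF, h⟩⟩

variable {κ : Type*} [Fintype κ]

/-- The linear forms that are the coordinates of a linear map. -/
noncomputable def linearForms (f : (ι → k) →ₗ[k] (κ → k)) (j : κ) : MvPolynomial ι k := by
  classical exact ∑ i, C (f (Pi.single i 1) j) * X i

theorem isHomogeneous_linearForms (f : (ι → k) →ₗ[k] (κ → k)) (j : κ) :
    (linearForms f j).IsHomogeneous 1 := by
  classical
  exact IsHomogeneous.sum _ _ _ fun i _ => isHomogeneous_C_mul_X _ _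

theorem eval_linearForms (f : (ι → k) →ₗ[k] (κ → k)) (j : κ) (v : ι → k) :
    eval v (linearForms f j) = f v j := by
  classical
  conv_rhs => rw [pi_eq_sum_univ' v]
  simp [linearForms, mul_comm]

/-- The pull-back of a polynomial under a linear map. -/
noncomputable def pullback (f : (ι → k) →ₗ[k] (κ → k)) (F : MvPolynomial κ k) :
    MvPolynomial ι k :=
  aeval (linearForms f) F

theorem isHomogeneous_pullback (f : (ι → k) →ₗ[k] (κ → k)) {F : MvPolynomial κ k} {d : ℕ}
    (hF : F.IsHomogeneous d) : (pullback f F).IsHomogeneous d := by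
  have h := hF.aeval (linearForms f) (isHomogeneous_linearForms f)
  rwa [one_mul] at h

theorem eval_pullback (f : (ι → k) →ₗ[k] (κ → k)) (F : MvPolynomial κ k) (v : ι → k) :
    eval v (pullback f F) = eval (f v) F := by
  have h : (eval v).comp (aeval (R := k) (linearForms f)).toRingHom = eval (f v) := by
    refine ringHom_ext (fun r => by simp) fun j => ?_
    simp [eval_linearForms]
  exact RingHom.congr_fun h F

theorem eval_rep_map_eq_zero_iff (f : (ι → k) →ₗ[k] (κ → k)) (hf : Function.Injective f)
    {F : MvPolynomial κ k} {d : ℕ} (hF : F.IsHomogeneous d) (x : ℙ k (ι → k)) :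
    eval (Projectivization.map f hf x).rep F = 0 ↔ eval (f x.rep) F = 0 := by
  conv_lhs => rw [← x.mk_rep, Projectivization.map_mk]
  exact eval_rep_mk_eq_zero_iff hF _ _

/-- A linear embedding of projective spaces is a closed embedding. -/
theorem map_image_closure (f : (ι → k) →ₗ[k] (κ → k)) (hf : Function.Injective f)
    (S : Set (ℙ k (ι → k))) :
    Projectivization.map f hf '' closure S = closure (Projectivization.map f hf '' S) := by
  apply Set.Subset.antisymm
  · rintro _ ⟨x, hx, rfl⟩
    rw [mem_closure_iff_forms] at hx ⊢
    rintro F ⟨⟨d, hF⟩, hFS⟩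
    rw [eval_rep_map_eq_zero_iff f hf hF, ← eval_pullback]
    refine hx _ ⟨⟨d, isHomogeneous_pullback f hF⟩, fun z hz => ?_⟩
    rw [eval_pullback, ← eval_rep_map_eq_zero_iff f hf hF]
    exact hFS _ ⟨z, hz, rfl⟩
  · intro y hy
    rw [mem_closure_iff_forms] at hy
    -- The left inverse `g` transports forms back from the source, and the coordinates of `f ∘ g -
    -- id` are linear forms that cut out the image of `f`.
    obtain ⟨g, hg⟩ := f.exists_leftInverse_of_injective (LinearMap.ker_eq_bot.2 hf)
    have hgf : ∀ v, g (f v) = v := fun v => LinearMap.congr_fun hg v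
    have hfg : f (g y.rep) = y.rep := by
      ext j
      have h1 := hy (linearForms (f ∘ₗ g - LinearMap.id) j)
        ⟨⟨1, isHomogeneous_linearForms _ _⟩, ?_⟩
      · rw [eval_linearForms] at h1
        simpa [sub_eq_zero] using h1
      · rintro _ ⟨x, -, rfl⟩
        rw [eval_rep_map_eq_zero_iff f hf (isHomogeneous_linearForms _ _), eval_linearForms]
        simp [hgf]
    have hne : g y.rep ≠ 0 := by
      intro h0
      rw [h0, map_zero] at hfg
      exact y.rep_nonzero hfg.symm
    refine ⟨Projectivization.mk k (g y.rep) hne, ?_, ?_⟩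
    · rw [mem_closure_iff_forms]
      rintro F ⟨⟨d, hF⟩, hFS⟩
      rw [eval_rep_mk_eq_zero_iff hF, ← eval_pullback]
      refine hy _ ⟨⟨d, isHomogeneous_pullback g hF⟩, ?_⟩
      rintro _ ⟨x, hx, rfl⟩
      rw [eval_rep_map_eq_zero_iff f hf (isHomogeneous_pullback g hF), eval_pullback, hgf]
      exact hFS x hx
    · rw [Projectivization.map_mk]
      conv_rhs => rw [← y.mk_rep]
      simp only [hfg]

end Zariski

/-! ### Binomial equations of diagonal group orbits. -/

section Binomials

variable {ι : Type*} [Fintype ι]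

/-- The monomial `y ^ α`. -/
def vpow {R : Type*} [CommMonoid R] (y : ι → R) (α : ι →₀ ℕ) : R := ∏ u, y u ^ α u

section

variable {R : Type*} [CommMonoid R]

theorem vpow_add (y : ι → R) (α β : ι →₀ ℕ) : vpow y (α + β) = vpow y α * vpow y β := by
  simp [vpow, pow_add, Finset.prod_mul_distrib]

theorem vpow_zero (y : ι → R) : vpow y 0 = 1 := by simp [vpow]

theorem vpow_nsmul (y : ι → R) (n : ℕ) (α : ι →₀ ℕ) : vpow y (n • α) = vpow y α ^ n := by
  simp [vpow, Finset.prod_pow, mul_comm n, pow_mul]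

theorem vpow_single (y : ι → R) (u : ι) (n : ℕ) : vpow y (Finsupp.single u n) = y u ^ n := by
  classical
  rw [vpow, Finset.prod_eq_single u]
  · simp
  · intro v _ hv
    simp [hv.symm]
  · simp

theorem vpow_mul (y z : ι → R) (α : ι →₀ ℕ) :
    vpow (fun u => y u * z u) α = vpow y α * vpow z α := by
  simp [vpow, mul_pow, Finset.prod_mul_distrib]

end

variable {k : Type*} [Field k]

theorem eval_monomial_eq (y : ι → k) (α : ι →₀ ℕ) (c : k) :
    eval y (monomial α c) = c * vpow y α := by
  rw [eval_monomial, Finsupp.prod_fintype _ _ (by simp), vpow]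

theorem coe_vpow (x : ι → kˣ) (α : ι →₀ ℕ) :
    ((vpow x α : kˣ) : k) = vpow (fun u => (x u : k)) α := by
  simp [vpow]

theorem vpow_ne_zero_iff (y : ι → k) (α : ι →₀ ℕ) :
    vpow y α ≠ 0 ↔ ∀ u, α u ≠ 0 → y u ≠ 0 := by
  simp only [vpow, Finset.prod_ne_zero_iff, Finset.mem_univ, true_implies]
  refine forall_congr' fun u => ?_
  by_cases h : α u = 0 <;> simp [h]

variable {G : Type*} [CommGroup G]

/-- The character by which `G` acts on the monomial with exponent `α`. -/
def charOf (χ : ι → G →* kˣ) (α : ι →₀ ℕ) : G →* kˣ := vpow χ α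

theorem charOf_apply (χ : ι → G →* kˣ) (α : ι →₀ ℕ) (g : G) :
    charOf χ α g = vpow (fun u => χ u g) α := by
  simp [charOf, vpow]

theorem linearIndependent_units_characters :
    LinearIndependent k fun f : G →* kˣ => (fun g => (f g : k) : G → k) :=
  (linearIndependent_monoidHom G k).comp (fun f : G →* kˣ => (Units.coeHom k).comp f) (by
    intro f g h
    ext x
    exact DFunLike.congr_fun h x)

/-- A polynomial vanishing on the image of a group under characters is a linear combination of
binomials. -/
theorem mem_span_binomials (χ : ι → G →* kˣ) (F : MvPolynomial ι k)
    (hF : ∀ g, eval (fun u => (χ u g : k)) F = 0) :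
    F ∈ Submodule.span k {P : MvPolynomial ι k | ∃ α β : ι →₀ ℕ, charOf χ α = charOf χ β ∧
      P = monomial α 1 - monomial β 1} := by
  classical
  set S := Submodule.span k {P : MvPolynomial ι k | ∃ α β : ι →₀ ℕ, charOf χ α = charOf χ β ∧
      P = monomial α 1 - monomial β 1} with hS
  -- Modulo binomials the class of a monomial depends only on its character; `φ` records this class.
  let φ : (G →* kˣ) → MvPolynomial ι k ⧸ S := fun f =>
    if h : ∃ α, charOf χ α = f then S.mkQ (monomial h.choose 1) else 0
  have hφ : ∀ α, φ (charOf χ α) = S.mkQ (monomial α 1) := by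
    intro α
    have h : ∃ β, charOf χ β = charOf χ α := ⟨α, rfl⟩
    have h1 : φ (charOf χ α) = S.mkQ (monomial h.choose 1) := dif_pos h
    rw [h1, ← sub_eq_zero, ← map_sub, Submodule.mkQ_apply, Submodule.Quotient.mk_eq_zero]
    exact Submodule.subset_span ⟨_, _, h.choose_spec, rfl⟩
  -- `D` adds up the coefficients of `F` over the monomials with a given character. By independence
  -- of characters all these sums vanish.
  let D : (G →* kˣ) →₀ k := ∑ α ∈ F.support, Finsupp.single (charOf χ α) (coeff α F)
  have hD : D = 0 := by
    have hli := linearIndependent_units_characters (k := k) (G := G)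
    rw [linearIndependent_iff] at hli
    refine hli D ?_
    ext g
    have := hF g
    rw [F.as_sum, map_sum] at this
    simp only [D, map_sum, Finsupp.linearCombination_single, Finset.sum_apply, Pi.smul_apply,
      smul_eq_mul, Pi.zero_apply]
    rw [← this]
    refine Finset.sum_congr rfl fun α _ => ?_
    rw [eval_monomial_eq, charOf_apply, coe_vpow]
  have h0 : Finsupp.linearCombination k φ D = S.mkQ F := by
    conv_rhs => rw [F.as_sum]
    simp only [D, map_sum, Finsupp.linearCombination_single, hφ]
    refine Finset.sum_congr rfl fun α _ => ?_
    rw [← map_smul, smul_monomial, smul_eq_mul, mul_one]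
  rw [hD, map_zero] at h0
  rw [← Submodule.Quotient.mk_eq_zero S]
  exact h0.symm

theorem eval_eq_zero_of_binomials (χ : ι → G →* kˣ) (y : ι → k)
    (hy : ∀ α β : ι →₀ ℕ, charOf χ α = charOf χ β → vpow y α = vpow y β)
    (F : MvPolynomial ι k) (hF : ∀ g, eval (fun u => (χ u g : k)) F = 0) : eval y F = 0 := by
  have h := mem_span_binomials χ F hF
  clear hF
  induction h using Submodule.span_induction with
  | mem P hP =>
    obtain ⟨α, β, h, rfl⟩ := hP
    simp [eval_monomial_eq, hy α β h]
  | zero => simp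
  | add P Q _ _ hP hQ => simp [hP, hQ]
  | smul c P _ hP => simp [hP, smul_eval]

variable [Nonempty ι]

theorem coe_units_ne_zero (x : ι → kˣ) : (fun u => (x u : k)) ≠ 0 := fun h =>
  (x (Classical.arbitrary ι)).ne_zero (congrFun h _)

/-- The point of projective space with the given nonzero homogeneous coordinates. -/
def torusPt (x : ι → kˣ) : ℙ k (ι → k) :=
  Projectivization.mk k (fun u => (x u : k)) (coe_units_ne_zero x)

theorem eval_rep_torusPt_eq_zero_iff {F : MvPolynomial ι k} {d : ℕ} (hF : F.IsHomogeneous d)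
    (x : ι → kˣ) : eval (torusPt x).rep F = 0 ↔ eval (fun u => (x u : k)) F = 0 :=
  eval_rep_mk_eq_zero_iff hF _ _

/-- The orbit of a point under a group that acts diagonally by characters. -/
def orbitSet (x : ι → kˣ) (χ : ι → G →* kˣ) : Set (ℙ k (ι → k)) :=
  Set.range fun g => torusPt fun u => x u * χ u g

/-- Multiplication of the coordinates by nonzero constants. -/
def diagMap (x : ι → kˣ) : (ι → k) →ₗ[k] (ι → k) where
  toFun v u := x u * v u
  map_add' v w := by ext; simp [mul_add]
  map_smul' c v := by ext; simp [mul_left_comm]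

/-- Dividing by the coordinates of `x` reduces to the orbit of the point with all coordinates `1`,
where every vanishing form is a combination of binomials. -/
theorem mem_closure_orbitSet (x : ι → kˣ) (χ : ι → G →* kˣ) (y : ℙ k (ι → k))
    (hy : ∀ α β : ι →₀ ℕ, charOf χ α = charOf χ β →
      vpow (fun u => (↑(x u)⁻¹ : k) * y.rep u) α = vpow (fun u => (↑(x u)⁻¹ : k) * y.rep u) β) :
    y ∈ closure (orbitSet x χ) := by
  rw [mem_closure_iff_forms]
  rintro F ⟨⟨d, hF⟩, hFS⟩
  have h := eval_eq_zero_of_binomials χ _ hy (pullback (diagMap x) F) fun g => by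
    rw [eval_pullback]
    have := (eval_rep_torusPt_eq_zero_iff hF _).1 (hFS _ ⟨g, rfl⟩)
    simpa [diagMap] using this
  rw [eval_pullback] at h
  convert h using 3
  simp [diagMap]

end Binomials

/-! ### Characters of a lattice and irreducibility of torus orbits. -/

section Irreducible

variable {ι : Type*} [Fintype ι] [Nonempty ι] {k : Type*} [Field k] [Infinite k]

theorem exists_units_zpow_ne_one (m : ℤ) (hm : m ≠ 0) : ∃ z : kˣ, z ^ m ≠ 1 := by
  by_contra! h
  have hn : 0 < m.natAbs := Int.natAbs_pos.2 hm
  have h1 : ∀ z : kˣ, z ^ m.natAbs = 1 := fun z => by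
    rcases Int.natAbs_eq m with h2 | h2
    · rw [← zpow_natCast, ← h2, h z]
    · have := h z
      rw [h2, zpow_neg, inv_eq_one, zpow_natCast] at this
      exact this
  have : Infinite kˣ := by
    by_contra hfin
    rw [not_infinite_iff_finite] at hfin
    have h2 : (Set.univ : Set k) ⊆ insert 0 (Set.range (Units.val : kˣ → k)) := by
      intro z _
      by_cases hz : z = 0
      · simp [hz]
      · exact Or.inr ⟨Units.mk0 z hz, rfl⟩
    exact Set.infinite_univ (((Set.finite_range _).insert 0).subset h2)
  have h3 : (Set.univ : Set kˣ) ⊆ (rootsOfUnity m.natAbs k : Set kˣ) := fun z _ => by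
    simpa [mem_rootsOfUnity] using h1 z
  have : NeZero m.natAbs := ⟨hn.ne'⟩
  have hfin : Finite (rootsOfUnity m.natAbs k) := inferInstance
  exact Set.infinite_univ (Set.Finite.subset (Set.finite_coe_iff.1 hfin) h3)

variable {M : Type*} [AddCommGroup M] [Module.Free ℤ M]

theorem exists_character_ne_one {m : M} (hm : m ≠ 0) :
    ∃ s : Multiplicative M →* kˣ, s (Multiplicative.ofAdd m) ≠ 1 := by
  let b := Module.Free.chooseBasis ℤ M
  obtain ⟨i, hi⟩ : ∃ i, b.coord i m ≠ 0 := by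
    by_contra! h
    exact hm (b.forall_coord_eq_zero_iff.1 h)
  obtain ⟨z, hz⟩ := exists_units_zpow_ne_one (k := k) _ hi
  exact ⟨(zpowersHom kˣ z).comp (AddMonoidHom.toMultiplicative (b.coord i).toAddMonoidHom), hz⟩

theorem eq_of_forall_character_eq {m m' : M}
    (h : ∀ s : Multiplicative M →* kˣ,
      s (Multiplicative.ofAdd m) = s (Multiplicative.ofAdd m')) : m = m' := by
  by_contra hne
  obtain ⟨s, hs⟩ := exists_character_ne_one (k := k) (sub_ne_zero.2 hne)
  exact hs (by rw [ofAdd_sub, map_div, h s, div_self'])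

/-- Evaluation of a character is a character. -/
def evalChar (m : M) : (Multiplicative M →* kˣ) →* kˣ :=
  MonoidHom.eval (Multiplicative.ofAdd m)

/-- The value of an element of the group algebra at a character. -/
noncomputable def algEval (s : Multiplicative M →* kˣ) : AddMonoidAlgebra k M →ₐ[k] k :=
  AddMonoidAlgebra.lift k k M ((Units.coeHom k).comp s)

theorem algEval_single (s : Multiplicative M →* kˣ) (m : M) (c : k) :
    algEval s (AddMonoidAlgebra.single m c) = c * s (Multiplicative.ofAdd m) := by
  simp [algEval]

/-- Over an infinite field the elements of a free `M` are separated by characters of `M`, so they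
define distinct, hence linearly independent, characters of the torus. -/
theorem eq_zero_of_algEval (f : AddMonoidAlgebra k M) (hf : ∀ s, algEval s f = 0) : f = 0 := by
  have hli := (linearIndependent_units_characters (k := k) (G := Multiplicative M →* kˣ)).comp
    (fun m : M => evalChar m) (by
      intro m m' h
      exact eq_of_forall_character_eq (k := k) fun s => DFunLike.congr_fun h s)
  rw [linearIndependent_iff] at hli
  have h : f.coeff = 0 := by
    refine hli _ ?_
    ext s
    have h1 := hf s
    rw [algEval, AddMonoidAlgebra.lift_apply] at h1
    rw [Finsupp.linearCombination_apply, Finsupp.sum, Finset.sum_apply]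
    exact h1
  ext m
  rw [h]
  rfl

/-- Forms on the orbit are read in the group algebra `k[M]`, a domain because `M` is torsion-free. A
product of two forms that are nonzero somewhere is thus nonzero at some character. -/
theorem isIrreducible_orbitSet [Module.Finite ℤ M] (x : ι → kˣ) (q : ι → M) :
    IsIrreducible (orbitSet x fun u => evalChar (k := k) (q u)) := by
  refine ⟨⟨_, 1, rfl⟩, ?_⟩
  rintro U V hU hV ⟨_, ⟨s, rfl⟩, hsU⟩ ⟨_, ⟨t, rfl⟩, htV⟩
  obtain ⟨d, F, hF, hFs, hFU⟩ := exists_form_of_isOpen hU hsU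
  obtain ⟨e, G, hG, hGt, hGV⟩ := exists_form_of_isOpen hV htV
  let φ : MvPolynomial ι k →ₐ[k] AddMonoidAlgebra k M :=
    aeval fun u => AddMonoidAlgebra.single (q u) (x u : k)
  have hφ : ∀ s P, algEval s (φ P) =
      eval (fun u => ((x u * evalChar (q u) s : kˣ) : k)) P := by
    intro s P
    have h : ((algEval s).comp φ).toRingHom =
        eval (fun u => ((x u * evalChar (q u) s : kˣ) : k)) := by
      refine ringHom_ext (fun r => by simp) fun j => ?_
      simp [φ, algEval_single, evalChar]
    exact RingHom.congr_fun h P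
  have : IsAddTorsionFree M := Module.isTorsionFree_int_iff_isAddTorsionFree.1 inferInstance
  have : AddMonoid.FG M :=
    AddGroup.fg_iff_addMonoid_fg.1 (Module.Finite.iff_addGroup_fg.1 inferInstance)
  have hFG : φ F * φ G ≠ 0 := by
    refine mul_ne_zero (fun h => ?_) fun h => ?_
    · refine (eval_rep_torusPt_eq_zero_iff hF _).not.1 hFs ?_
      rw [← hφ, h, map_zero]
    · refine (eval_rep_torusPt_eq_zero_iff hG _).not.1 hGt ?_
      rw [← hφ, h, map_zero]
  rw [← map_mul] at hFG
  obtain ⟨g, hg⟩ : ∃ g, algEval g (φ (F * G)) ≠ 0 := by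
    by_contra! h
    exact hFG (eq_zero_of_algEval _ h)
  rw [hφ, map_mul] at hg
  refine ⟨_, ⟨g, rfl⟩, hFU ?_, hGV ?_⟩
  · exact (eval_rep_torusPt_eq_zero_iff hF _).not.2 (left_ne_zero_of_mul hg)
  · exact (eval_rep_torusPt_eq_zero_iff hG _).not.2 (right_ne_zero_of_mul hg)

end Irreducible

end ToricGauss

namespace ToricGauss

open MvPolynomial

/-! ### Weights of monomials. -/

section Weights

variable {ι : Type*} [Fintype ι] {M : Type*} [AddCommGroup M]

/-- The weight of the monomial with exponent `α`, when the variables have weights `q`. -/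
def weight (q : ι → M) (α : ι →₀ ℕ) : M := ∑ u, α u • q u

theorem weight_add (q : ι → M) (α β : ι →₀ ℕ) : weight q (α + β) = weight q α + weight q β := by
  simp [weight, add_smul, Finset.sum_add_distrib]

theorem weight_zero (q : ι → M) : weight q 0 = 0 := by simp [weight]

theorem weight_single (q : ι → M) (u : ι) (n : ℕ) : weight q (Finsupp.single u n) = n • q u := by
  classical
  rw [weight, Finset.sum_eq_single u]
  · simp
  · intro v _ hv
    simp [hv.symm]
  · simp

theorem weight_nsmul (q : ι → M) (n : ℕ) (α : ι →₀ ℕ) : weight q (n • α) = n • weight q α := by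
  simp [weight, Finset.smul_sum, mul_smul]

theorem map_weight {M' : Type*} [AddCommGroup M'] (f : M →+ M') (q : ι → M) (α : ι →₀ ℕ) :
    f (weight q α) = weight (fun u => f (q u)) α := by
  simp [weight]

theorem charOf_evalChar {k : Type*} [Field k] (q : ι → M) (α : ι →₀ ℕ) :
    charOf (fun u => evalChar (k := k) (q u)) α = evalChar (weight q α) := by
  ext s
  simp [charOf, vpow, evalChar, weight]

end Weights

theorem evalChar_injective {k : Type*} [Field k] [Infinite k] {M : Type*} [AddCommGroup M]
    [Module.Free ℤ M] : Function.Injective (evalChar (k := k) (M := M)) := fun _ _ h =>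
  eq_of_forall_character_eq (k := k) fun s => DFunLike.congr_fun h s

/-! ### Barycentric coordinates and tangent spaces of toric varieties. -/

section Torus

variable {k : Type*} [Field k] [Infinite k] {ι I : Type*} [Fintype ι] [Fintype I]
  [DecidableEq I]

/-- The weights `a u` span an affine lattice with affine basis `a (v i)`, in terms of barycentric
coordinates. -/
structure IsAffineFrame (a : ι → I → ℤ) (v : I → ι) : Prop where
  sum_eq_one : ∀ u, ∑ i, a u i = 1
  frame : ∀ i, a (v i) = Pi.single i 1

variable [Nonempty ι]

variable (k) in
/-- The closure of the image of the torus with character lattice `I → ℤ`. -/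
def toricClosure (a : ι → I → ℤ) : Set (ℙ k (ι → k)) :=
  closure (orbitSet 1 fun u => evalChar (k := k) (a u))

variable {a : ι → I → ℤ} {v : I → ι}

theorem IsAffineFrame.sum_weight (h : IsAffineFrame a v) (α : ι →₀ ℕ) :
    ∑ i, weight a α i = α.degree := by
  have h1 := map_weight (∑ i, Pi.evalAddMonoidHom (fun _ : I => ℤ) i) a α
  simp only [AddMonoidHom.finsetSum_apply, Pi.evalAddMonoidHom_apply, h.sum_eq_one] at h1
  rw [h1, Finsupp.degree_eq_sum]
  simp [weight]

theorem IsAffineFrame.degree_eq (h : IsAffineFrame a v) {α β : ι →₀ ℕ}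
    (hαβ : weight a α = weight a β) : α.degree = β.degree := by
  have := h.sum_weight α
  rw [hαβ, h.sum_weight β] at this
  exact_mod_cast this.symm

theorem eval_binomial_eq_zero {α β : ι →₀ ℕ} (hαβ : weight a α = weight a β)
    (s : Multiplicative (I → ℤ) →* kˣ) :
    eval (fun u => ((evalChar (a u) s : kˣ) : k)) (monomial α 1 - monomial β 1) = 0 := by
  have h1 : charOf (fun u => evalChar (k := k) (a u)) α = charOf (fun u => evalChar (a u)) β := by
    rw [charOf_evalChar, charOf_evalChar, hαβ]
  rw [map_sub, eval_monomial_eq, eval_monomial_eq, ← coe_vpow, ← coe_vpow, ← charOf_apply,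
    ← charOf_apply, h1, sub_self]

theorem IsAffineFrame.isHomogeneous_binomial (h : IsAffineFrame a v) {α β : ι →₀ ℕ}
    (hαβ : weight a α = weight a β) :
    (monomial α 1 - monomial β 1 : MvPolynomial ι k).IsHomogeneous α.degree :=
  (isHomogeneous_monomial _ rfl).sub (isHomogeneous_monomial _ (h.degree_eq hαβ).symm)

theorem IsAffineFrame.binomial_mem_vanishingForms (h : IsAffineFrame a v) {α β : ι →₀ ℕ}
    (hαβ : weight a α = weight a β) :
    (monomial α 1 - monomial β 1 : MvPolynomial ι k) ∈ vanishingForms (toricClosure k a) := by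
  rw [toricClosure, vanishingForms_closure]
  refine ⟨⟨_, h.isHomogeneous_binomial hαβ⟩, ?_⟩
  rintro _ ⟨s, rfl⟩
  rw [eval_rep_torusPt_eq_zero_iff (h.isHomogeneous_binomial hαβ)]
  simpa using eval_binomial_eq_zero (k := k) hαβ s

theorem mem_span_binomials_of_vanishing {F : MvPolynomial ι k}
    (hF : ∀ s : Multiplicative (I → ℤ) →* kˣ,
      eval (fun u => ((evalChar (a u) s : kˣ) : k)) F = 0) :
    F ∈ Submodule.span k {P : MvPolynomial ι k | ∃ α β : ι →₀ ℕ, weight a α = weight a β ∧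
      P = monomial α 1 - monomial β 1} := by
  refine Submodule.span_mono ?_ (mem_span_binomials (fun u => evalChar (k := k) (a u)) F hF)
  rintro P ⟨α, β, h, rfl⟩
  rw [charOf_evalChar, charOf_evalChar] at h
  exact ⟨α, β, evalChar_injective h, rfl⟩

theorem eval_eq_zero_of_mem_vanishingForms {F : MvPolynomial ι k}
    (hF : F ∈ vanishingForms (toricClosure k a)) (s : Multiplicative (I → ℤ) →* kˣ) :
    eval (fun u => ((evalChar (a u) s : kˣ) : k)) F = 0 := by
  obtain ⟨⟨d, hd⟩, hF⟩ := hF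
  have h := hF _ (subset_closure ⟨s, rfl⟩)
  rw [eval_rep_torusPt_eq_zero_iff hd] at h
  simpa using h

theorem IsAffineFrame.vpow_eq (h : IsAffineFrame a v) {y : ℙ k (ι → k)}
    (hy : y ∈ toricClosure k a) {α β : ι →₀ ℕ} (hαβ : weight a α = weight a β) :
    vpow y.rep α = vpow y.rep β := by
  have h1 := (h.binomial_mem_vanishingForms (k := k) hαβ).2 y hy
  rwa [map_sub, eval_monomial_eq, eval_monomial_eq, one_mul, one_mul, sub_eq_zero] at h1

/-- The derivative of the monomial with exponent `α` at `y` in the direction `w`. -/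
noncomputable def dmon (α : ι →₀ ℕ) (y w : ι → k) : k :=
  ∑ u, (α u : k) * vpow y (α - Finsupp.single u 1) * w u

theorem polyDifferential_monomial (α : ι →₀ ℕ) (y w : ι → k) :
    polyDifferential (monomial α 1) y w = dmon α y w := by
  classical
  simp [polyDifferential, dmon, pderiv_monomial, eval_monomial_eq]

theorem polyDifferential_add (F G : MvPolynomial ι k) (y : ι → k) :
    polyDifferential (F + G) y = polyDifferential F y + polyDifferential G y := by
  simp [polyDifferential, add_smul, Finset.sum_add_distrib]

theorem polyDifferential_smul (c : k) (F : MvPolynomial ι k) (y : ι → k) :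
    polyDifferential (c • F) y = c • polyDifferential F y := by
  simp [polyDifferential, smul_eval, mul_smul, Finset.smul_sum]

theorem polyDifferential_sub (F G : MvPolynomial ι k) (y : ι → k) :
    polyDifferential (F - G) y = polyDifferential F y - polyDifferential G y := by
  rw [sub_eq_add_neg, ← neg_one_smul k G, polyDifferential_add, polyDifferential_smul]
  exact LinearMap.ext fun w => by simp [sub_eq_add_neg]

/-- Vanishing forms are combinations of binomials with constant coefficients, and the differential
is `k`-linear in the form, so the binomials already give all tangent equations. -/
theorem IsAffineFrame.mem_embTangent_iff (h : IsAffineFrame a v) {y : ℙ k (ι → k)}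
    {w : ι → k} : w ∈ embTangent (toricClosure k a) y ↔
      ∀ α β, weight a α = weight a β → dmon α y.rep w = dmon β y.rep w := by
  simp only [embTangent, Submodule.mem_iInf, LinearMap.mem_ker]
  constructor
  · intro hw α β hαβ
    have h1 := hw _ (h.binomial_mem_vanishingForms hαβ)
    rwa [polyDifferential_sub, LinearMap.sub_apply, polyDifferential_monomial,
      polyDifferential_monomial, sub_eq_zero] at h1
  · intro hw F hF
    have h1 := mem_span_binomials_of_vanishing (eval_eq_zero_of_mem_vanishingForms hF)
    clear hF
    induction h1 using Submodule.span_induction with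
    | mem P hP =>
      obtain ⟨α, β, hαβ, rfl⟩ := hP
      rw [polyDifferential_sub, LinearMap.sub_apply, polyDifferential_monomial,
        polyDifferential_monomial, sub_eq_zero, hw α β hαβ]
    | zero => simp [polyDifferential]
    | add P Q _ _ hP hQ => rw [polyDifferential_add, LinearMap.add_apply, hP, hQ, add_zero]
    | smul c P _ hP => rw [polyDifferential_smul, LinearMap.smul_apply, hP, smul_zero]

/-- If `y` has no zero among the coordinates occurring in `α`, the derivative of `y ^ α` is
logarithmic. -/
theorem dmon_mul (α : ι →₀ ℕ) (y f : ι → k) :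
    dmon α y (fun u => y u * f u) = vpow y α * ∑ u, (α u : k) * f u := by
  rw [dmon, Finset.mul_sum]
  refine Finset.sum_congr rfl fun u _ => ?_
  rcases Nat.eq_zero_or_pos (α u) with h0 | h0
  · simp [h0]
  · have hle : Finsupp.single u 1 ≤ α := by
      rw [Finsupp.single_le_iff]
      exact h0
    have h1 : vpow y α = vpow y (α - Finsupp.single u 1) * y u := by
      conv_lhs => rw [← tsub_add_cancel_of_le hle, vpow_add, vpow_single, pow_one]
    rw [h1]
    ring

/-- The function on the weights that is given by an affine function with values `x` at the frame. -/
def affFun (a : ι → I → ℤ) : (I → k) →ₗ[k] (ι → k) where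
  toFun x u := ∑ i, (a u i : k) * x i
  map_add' x y := by ext; simp [mul_add, Finset.sum_add_distrib]
  map_smul' c x := by ext; simp [Finset.mul_sum, mul_left_comm]

theorem affFun_apply (a : ι → I → ℤ) (x : I → k) (u : ι) :
    affFun a x u = ∑ i, (a u i : k) * x i := rfl

theorem IsAffineFrame.affFun_frame (h : IsAffineFrame a v) (x : I → k) (i : I) :
    affFun a x (v i) = x i := by
  simp [affFun_apply, h.frame, Pi.single_apply]

theorem IsAffineFrame.affFun_const (h : IsAffineFrame a v) (c : k) :
    affFun a (fun _ => c) = fun _ => c := by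
  ext u
  have h1 := congrArg (Int.cast : ℤ → k) (h.sum_eq_one u)
  push_cast at h1
  rw [affFun_apply, ← Finset.sum_mul, h1, one_mul]

theorem sum_mul_affFun (α : ι →₀ ℕ) (x : I → k) :
    ∑ u, (α u : k) * affFun a x u = ∑ i, (weight a α i : k) * x i := by
  simp only [affFun_apply, weight, Finset.mul_sum, Finset.sum_apply, Pi.smul_apply]
  rw [Finset.sum_comm]
  refine Finset.sum_congr rfl fun i _ => ?_
  push_cast
  rw [Finset.sum_mul]
  refine Finset.sum_congr rfl fun u _ => ?_
  simp
  ring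

/-- The exponent on the frame that has as weight the positive part of `m`. -/
noncomputable def posExp (v : I → ι) (m : I → ℤ) : ι →₀ ℕ :=
  ∑ i, Finsupp.single (v i) (m i).toNat

theorem vpow_sum {R : Type*} [CommMonoid R] {J : Type*} (s : Finset J) (y : ι → R)
    (f : J → ι →₀ ℕ) : vpow y (∑ j ∈ s, f j) = ∏ j ∈ s, vpow y (f j) := by
  classical
  induction s using Finset.induction_on with
  | empty => simp [vpow_zero]
  | insert j s hj ih => rw [Finset.sum_insert hj, Finset.prod_insert hj, vpow_add, ih]

theorem weight_sum {M : Type*} [AddCommGroup M] {J : Type*} (s : Finset J) (q : ι → M)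
    (f : J → ι →₀ ℕ) : weight q (∑ j ∈ s, f j) = ∑ j ∈ s, weight q (f j) := by
  classical
  induction s using Finset.induction_on with
  | empty => simp [weight_zero]
  | insert j s hj ih => rw [Finset.sum_insert hj, Finset.sum_insert hj, weight_add, ih]

theorem vpow_posExp {R : Type*} [CommMonoid R] (y : ι → R) (m : I → ℤ) :
    vpow y (posExp v m) = ∏ i, y (v i) ^ (m i).toNat := by
  simp [posExp, vpow_sum, vpow_single]

theorem IsAffineFrame.weight_posExp (h : IsAffineFrame a v) (m : I → ℤ) :
    weight a (posExp v m) = fun i => max (m i) 0 := by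
  ext i
  simp [posExp, weight_sum, weight_single, h.frame, Finset.sum_apply, Pi.single_apply]

theorem IsAffineFrame.weight_posExp_sub (h : IsAffineFrame a v) (m : I → ℤ) :
    weight a (posExp v m) - weight a (posExp v (-m)) = m := by
  ext i
  simp only [h.weight_posExp, Pi.sub_apply, Pi.neg_apply]
  rcases le_total (m i) 0 with h0 | h0
  · simp [h0]
  · simp [h0]

/-- Moving the negative barycentric coordinates of `u` to the other side turns its expression by the
frame into a binomial relation that is linear in the coordinate `u`. -/
theorem IsAffineFrame.weight_single_add_posExp (h : IsAffineFrame a v) (u : ι) :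
    weight a (Finsupp.single u 1 + posExp v (-a u)) = weight a (posExp v (a u)) := by
  rw [weight_add, weight_single, one_smul]
  exact (sub_eq_iff_eq_add.1 (h.weight_posExp_sub (a u))).symm

/-- The character of the lattice `I → ℤ` with values `t` at the standard basis. -/
def charOfValues (t : I → kˣ) : Multiplicative (I → ℤ) →* kˣ where
  toFun m := ∏ i, t i ^ (Multiplicative.toAdd m i)
  map_one' := by simp
  map_mul' m n := by simp [zpow_add, Finset.prod_mul_distrib]

theorem charOfValues_ofAdd (t : I → kˣ) (m : I → ℤ) :
    charOfValues t (Multiplicative.ofAdd m) = ∏ i, t i ^ m i := rfl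

theorem prod_zpow_eq (t : I → kˣ) (m : I → ℤ) :
    (∏ i, t i ^ m i) * ∏ i, t i ^ ((-m) i).toNat = ∏ i, t i ^ (m i).toNat := by
  rw [← Finset.prod_mul_distrib]
  refine Finset.prod_congr rfl fun i _ => ?_
  rw [← zpow_natCast, ← zpow_natCast, ← zpow_add]
  congr 1
  simp only [Pi.neg_apply]
  omega

/-- The points of the toric variety without zero coordinates are those of the torus. -/
theorem IsAffineFrame.exists_character (h : IsAffineFrame a v) {y : ℙ k (ι → k)}
    (hy : y ∈ toricClosure k a) (hy0 : ∀ u, y.rep u ≠ 0) :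
    ∃ s : Multiplicative (I → ℤ) →* kˣ, ∀ u, y.rep u = (evalChar (a u) s : kˣ) := by
  let z : ι → kˣ := fun u => Units.mk0 _ (hy0 u)
  have hz : ∀ α, vpow y.rep α = (vpow z α : kˣ) := fun α => by rw [coe_vpow]; rfl
  refine ⟨charOfValues fun i => z (v i), fun u => ?_⟩
  have h1 := h.vpow_eq hy (h.weight_single_add_posExp u)
  rw [hz, hz, Units.val_inj, vpow_add, vpow_single, pow_one, vpow_posExp, vpow_posExp,
    ← prod_zpow_eq _ (a u)] at h1
  exact congrArg Units.val (mul_right_cancel h1)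

/-- At a point of the torus the embedded tangent space consists of the affine functions. -/
theorem IsAffineFrame.mem_embTangent_iff_of_ne_zero (h : IsAffineFrame a v) {y : ℙ k (ι → k)}
    (hy : y ∈ toricClosure k a) (hy0 : ∀ u, y.rep u ≠ 0) {w : ι → k} :
    w ∈ embTangent (toricClosure k a) y ↔
      ∃ x : I → k, ∀ u, w u = y.rep u * affFun a x u := by
  rw [h.mem_embTangent_iff]
  have hw : w = fun u => y.rep u * (w u / y.rep u) := by
    ext u
    rw [mul_div_cancel₀ _ (hy0 u)]
  constructor
  · intro hw1
    -- The affine function is forced by its values at the frame; the binomial attached to `u` then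
    -- determines its value at `u`.
    refine ⟨fun i => w (v i) / y.rep (v i), fun u => ?_⟩
    have h1 := hw1 _ _ (h.weight_single_add_posExp u)
    rw [hw, dmon_mul, dmon_mul, h.vpow_eq hy (h.weight_single_add_posExp u)] at h1
    have h2 := mul_left_cancel₀ ((vpow_ne_zero_iff _ _).2 fun u _ => hy0 u) h1
    have h3 : ∀ (m : I → ℤ) (f : ι → k),
        ∑ u, ((posExp v m u : ℕ) : k) * f u = ∑ i, ((m i).toNat : k) * f (v i) := by
      intro m f
      classical
      simp only [posExp, Finsupp.finsetSum_apply, Nat.cast_sum, Finset.sum_mul]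
      rw [Finset.sum_comm]
      simp [Finsupp.single_apply]
    classical
    simp only [Finsupp.add_apply, Nat.cast_add, add_mul, Finset.sum_add_distrib, h3] at h2
    have h4 : ∑ u', ((Finsupp.single u 1 u' : ℕ) : k) * (w u' / y.rep u') = w u / y.rep u := by
      simp [Finsupp.single_apply]
    rw [h4, ← eq_sub_iff_add_eq, ← Finset.sum_sub_distrib] at h2
    rw [mul_comm, ← div_eq_iff (hy0 u), h2, affFun_apply]
    refine Finset.sum_congr rfl fun i _ => ?_
    rw [← sub_mul]
    congr 1
    have h5 : a u i = (a u i).toNat - ((-a u) i).toNat := by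
      simp only [Pi.neg_apply]
      omega
    conv_rhs => rw [h5]
    push_cast
    rfl
  · rintro ⟨x, hx⟩ α β hαβ
    obtain rfl : w = fun u => y.rep u * affFun a x u := funext hx
    rw [dmon_mul, dmon_mul, h.vpow_eq hy hαβ, sum_mul_affFun, sum_mul_affFun, hαβ]

end Torus

end ToricGauss

namespace ToricGauss

open MvPolynomial

/-! ### Dimension and smoothness at torus points. -/

section Dimension

variable {k : Type*} [Field k] [Infinite k] {ι I : Type*} [Fintype ι] [Fintype I]
  [DecidableEq I] [Nonempty ι] {a : ι → I → ℤ} {v : I → ι}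

/-- Embeds the homogeneous coordinate ring in the group algebra of `I → ℤ`, which gives primality of
the ideal. -/
theorem IsAffineFrame.mem_vanishingIdeal_iff (h : IsAffineFrame a v) (F : MvPolynomial ι k) :
    F ∈ vanishingIdeal (toricClosure k a) ↔
      aeval (fun u => AddMonoidAlgebra.single (a u) (1 : k)) F = 0 := by
  have hφ : ∀ s P, algEval s (aeval (fun u => AddMonoidAlgebra.single (a u) (1 : k)) P) =
      eval (fun u => ((evalChar (a u) s : kˣ) : k)) P := by
    intro s P
    have h : ((algEval s).comp
        (aeval (fun u => AddMonoidAlgebra.single (a u) (1 : k)))).toRingHom =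
        eval (fun u => ((evalChar (a u) s : kˣ) : k)) := by
      refine ringHom_ext (fun r => by simp) fun j => ?_
      simp [algEval_single, evalChar]
    exact RingHom.congr_fun h P
  constructor
  · intro hF
    have hle : vanishingIdeal (toricClosure k a) ≤
        RingHom.ker (aeval (R := k) fun u => AddMonoidAlgebra.single (a u) (1 : k)) := by
      refine Ideal.span_le.2 fun P hP => ?_
      exact eq_zero_of_algEval _ fun s => by
        rw [hφ, eval_eq_zero_of_mem_vanishingForms hP]
    exact hle hF
  · intro hF
    have h1 := mem_span_binomials_of_vanishing (a := a) (F := F) fun s => by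
      rw [← hφ, hF, map_zero]
    have hle : Submodule.span k {P : MvPolynomial ι k | ∃ α β : ι →₀ ℕ,
        weight a α = weight a β ∧ P = monomial α 1 - monomial β 1} ≤
        (vanishingIdeal (toricClosure k a)).restrictScalars k := by
      refine Submodule.span_le.2 ?_
      rintro _ ⟨α, β, hαβ, rfl⟩
      exact Ideal.subset_span (h.binomial_mem_vanishingForms hαβ)
    exact hle h1

theorem IsAffineFrame.isPrime_vanishingIdeal (h : IsAffineFrame a v) :
    (vanishingIdeal (toricClosure k a)).IsPrime := by
  have : vanishingIdeal (toricClosure k a) =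
      RingHom.ker (aeval (R := k) fun u => AddMonoidAlgebra.single (a u) (1 : k)) := by
    ext F
    exact h.mem_vanishingIdeal_iff F
  rw [this]
  exact RingHom.ker_isPrime _

/-- The coordinates at the frame form a transcendence basis. They are independent because arbitrary
nonzero values at the frame come from a character, and every other coordinate solves a linear
equation over them. -/
theorem IsAffineFrame.trdeg_eq (h : IsAffineFrame a v) :
    Cardinal.toNat (Algebra.trdeg k (MvPolynomial ι k ⧸ vanishingIdeal (toricClosure k a))) =
      Fintype.card I := by
  have hprime := h.isPrime_vanishingIdeal (k := k)
  set J := vanishingIdeal (toricClosure k a) with hJ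
  let y : I → MvPolynomial ι k ⧸ J := fun i => Ideal.Quotient.mk J (X (v i))
  have hind : AlgebraicIndependent k y := by
    rw [algebraicIndependent_iff]
    intro P hP
    have h1 : Ideal.Quotient.mk J (rename v P) = 0 := by
      rw [← hP]
      have h2 : ((Ideal.Quotient.mkₐ k J).comp (rename v)) = aeval y := by
        refine algHom_ext fun i => ?_
        simp [y]
      exact DFunLike.congr_fun h2 P
    rw [Ideal.Quotient.eq_zero_iff_mem, hJ, h.mem_vanishingIdeal_iff] at h1
    refine funext_set (fun _ => {0}ᶜ) (fun _ => (Set.finite_singleton 0).infinite_compl) ?_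
    intro t ht
    have ht0 : ∀ i, t i ≠ 0 := fun i => ht i (Set.mem_univ i)
    let s := charOfValues fun i => Units.mk0 (t i) (ht0 i)
    have h3 := congrArg (algEval s) h1
    rw [map_zero, aeval_rename] at h3
    rw [map_zero, ← h3]
    have h4 : ((algEval s).comp (aeval ((fun u => AddMonoidAlgebra.single (a u) (1 : k)) ∘ v))) =
        aeval t := by
      refine algHom_ext fun i => ?_
      simp [algEval_single, s, charOfValues_ofAdd, h.frame, Pi.single_apply]
    exact (DFunLike.congr_fun h4 P).symm
  have hbasis : IsTranscendenceBasis k y := by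
    rw [hind.isTranscendenceBasis_iff_isAlgebraic]
    set B := Algebra.adjoin k (Set.range y)
    have hyB : ∀ i, y i ∈ B := fun i => Algebra.subset_adjoin ⟨i, rfl⟩
    have hmon : ∀ m : I → ℤ, Ideal.Quotient.mk J (monomial (posExp v m) 1) =
        ∏ i, y i ^ (m i).toNat := by
      intro m
      have : (monomial (posExp v m) 1 : MvPolynomial ι k) = ∏ i, X (v i) ^ (m i).toNat := by
        simp only [posExp, monomial_sum_one, X_pow_eq_monomial]
      rw [this, map_prod]
      simp [y]
    have hX : ∀ u, IsAlgebraic B (Ideal.Quotient.mk J (X u)) := by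
      intro u
      let e : B := ⟨∏ i, y i ^ ((-a u) i).toNat, prod_mem fun i _ => pow_mem (hyB i) _⟩
      let e' : B := ⟨∏ i, y i ^ ((a u) i).toNat, prod_mem fun i _ => pow_mem (hyB i) _⟩
      have he : e ≠ 0 := by
        intro h0
        have h1 : ∏ i, y i ^ ((-a u) i).toNat = 0 := congrArg Subtype.val h0
        rw [Finset.prod_eq_zero_iff] at h1
        obtain ⟨i, -, hi⟩ := h1
        exact hind.ne_zero i (eq_zero_of_pow_eq_zero hi)
      refine ⟨Polynomial.C e * Polynomial.X - Polynomial.C e', ?_, ?_⟩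
      · intro h0
        have h1 := congrArg (fun q => Polynomial.coeff q 1) h0
        simp [Polynomial.coeff_C] at h1
        exact he h1
      · have h1 := Ideal.subset_span (h.binomial_mem_vanishingForms (k := k)
          (h.weight_single_add_posExp u))
        have h2 : Ideal.Quotient.mk J _ = 0 := Ideal.Quotient.eq_zero_iff_mem.2 h1
        rw [map_sub, hmon] at h2
        have h3 : (monomial (Finsupp.single u 1 + posExp v (-a u)) 1 : MvPolynomial ι k) =
            X u * monomial (posExp v (-a u)) 1 := by
          rw [X, monomial_mul, one_mul]
        rw [h3, map_mul, hmon] at h2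
        simp only [map_sub, map_mul, Polynomial.aeval_C, Polynomial.aeval_X]
        rw [mul_comm]
        exact h2
    refine ⟨fun x => ?_⟩
    obtain ⟨P, rfl⟩ := Ideal.Quotient.mk_surjective x
    induction P using MvPolynomial.induction_on with
    | C c =>
      have : Ideal.Quotient.mk J (C c) = algebraMap B _ (algebraMap k B c) := rfl
      rw [this]
      exact isAlgebraic_algebraMap _
    | add P Q hP hQ => rw [map_add]; exact hP.add hQ
    | mul_X P u hP => rw [map_mul]; exact hP.mul (hX u)
  have h1 := hbasis.lift_cardinalMk_eq_trdeg
  have h2 := congrArg Cardinal.toNat h1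
  simpa using h2.symm

theorem IsAffineFrame.nonempty_index (h : IsAffineFrame a v) : Nonempty I := by
  by_contra hI
  rw [not_nonempty_iff] at hI
  have := h.sum_eq_one (Classical.arbitrary ι)
  simp at this

theorem IsAffineFrame.dim_add_one (h : IsAffineFrame a v) :
    dim (toricClosure k a) + 1 = Fintype.card I := by
  have := h.nonempty_index
  rw [dim, h.trdeg_eq]
  exact Nat.sub_add_cancel Fintype.card_pos

variable (a) in
/-- The embedded tangent space at a point of the torus with coordinates `y`, parametrized by the
values of an affine function at the frame. -/
def tangentParam (y : ι → k) : (I → k) →ₗ[k] (ι → k) where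
  toFun x u := y u * affFun a x u
  map_add' x x' := by ext; simp [mul_add]
  map_smul' c x := by ext; simp [mul_left_comm]

theorem tangentParam_apply (y : ι → k) (x : I → k) (u : ι) :
    tangentParam a y x u = y u * affFun a x u := rfl

theorem IsAffineFrame.tangentParam_injective (h : IsAffineFrame a v) {y : ι → k}
    (hy : ∀ u, y u ≠ 0) : Function.Injective (tangentParam a y) := by
  intro x x' hx
  ext i
  have h1 := congrFun hx (v i)
  rw [tangentParam_apply, tangentParam_apply, h.affFun_frame, h.affFun_frame] at h1
  exact mul_left_cancel₀ (hy _) h1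

theorem IsAffineFrame.embTangent_eq (h : IsAffineFrame a v) {y : ℙ k (ι → k)}
    (hy : y ∈ toricClosure k a) (hy0 : ∀ u, y.rep u ≠ 0) :
    embTangent (toricClosure k a) y = LinearMap.range (tangentParam a y.rep) := by
  ext w
  rw [h.mem_embTangent_iff_of_ne_zero hy hy0, LinearMap.mem_range]
  exact ⟨fun ⟨x, hx⟩ => ⟨x, (funext hx).symm⟩, fun ⟨x, hx⟩ => ⟨x, fun u => (congrFun hx u).symm⟩⟩

theorem IsAffineFrame.mem_smoothLocus (h : IsAffineFrame a v) {y : ℙ k (ι → k)}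
    (hy : y ∈ toricClosure k a) (hy0 : ∀ u, y.rep u ≠ 0) :
    y ∈ smoothLocus (toricClosure k a) := by
  refine ⟨hy, ?_⟩
  rw [h.embTangent_eq hy hy0, h.dim_add_one,
    LinearMap.finrank_range_of_inj (h.tangentParam_injective hy0), Module.finrank_fintype_fun_eq_card]

/-- The open set of points without zero coordinates. -/
def nonzeroLocus (k : Type*) [Field k] (ι : Type*) : Set (ℙ k (ι → k)) :=
  {y | ∀ u, y.rep u ≠ 0}

theorem isOpen_nonzeroLocus : IsOpen (nonzeroLocus k ι) := by
  have : nonzeroLocus k ι = {y : ℙ k (ι → k) | eval y.rep (∏ u, X u) ≠ 0} := by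
    ext y
    simp [nonzeroLocus, Finset.prod_ne_zero_iff]
  rw [this]
  exact isOpen_eval_ne_zero (IsHomogeneous.prod _ _ _ fun u _ => isHomogeneous_X _ _)

theorem torusPt_mem_nonzeroLocus (x : ι → kˣ) : torusPt x ∈ nonzeroLocus k ι := by
  intro u
  have := (eval_rep_torusPt_eq_zero_iff (isHomogeneous_X k u) x).not.2 (by simp)
  simpa using this

theorem forGeneralPoint_of_torus {P : smoothLocus (toricClosure k a) → Prop}
    (h : IsAffineFrame a v)
    (hP : ∀ y : smoothLocus (toricClosure k a), (∀ u, y.1.rep u ≠ 0) → P y) :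
    ForGeneralPoint (toricClosure k a) P := by
  refine ⟨nonzeroLocus k ι, isOpen_nonzeroLocus, ?_, ?_⟩
  · refine closure_mono ?_
    rintro _ ⟨s, rfl⟩
    exact ⟨subset_closure ⟨s, rfl⟩, torusPt_mem_nonzeroLocus _⟩
  · rintro y ⟨hy, hy0⟩
    exact ⟨h.mem_smoothLocus hy hy0, hP _ hy0⟩

end Dimension

end ToricGauss

namespace ToricGauss

open MvPolynomial

/-! ### Equations of the fibers of the Gauss map, including points outside the torus. -/

section Fibers

variable {k : Type*} [Field k] [Infinite k] {ι I : Type*} [Fintype ι] [Fintype I]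
  [DecidableEq I] [Nonempty ι] {a : ι → I → ℤ} {v : I → ι}

/-- The function `d` on the weights is constant along each pair of a weight and an element of the
frame which occurs in it with a coefficient that is nonzero in `k`. -/
def EdgeInvariant (a : ι → I → ℤ) (v : I → ι) (d : ι → k) : Prop :=
  ∀ u i, (a u i : k) ≠ 0 → d u = d (v i)

theorem IsAffineFrame.mul_affFun (d : ι → k) (hd : EdgeInvariant a v d)
    (x : I → k) (u : ι) :
    d u * affFun a x u = affFun a (fun i => d (v i) * x i) u := by
  rw [affFun_apply, affFun_apply, Finset.mul_sum]
  refine Finset.sum_congr rfl fun i _ => ?_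
  by_cases h0 : (a u i : k) = 0
  · simp [h0]
  · rw [hd u i h0]
    ring

/-- Multiplication by a function preserves the space of affine functions if and only if the
function is edge invariant. -/
theorem IsAffineFrame.edgeInvariant_iff (h : IsAffineFrame a v) (d : ι → k) :
    EdgeInvariant a v d ↔
      ∀ x : I → k, ∃ x' : I → k, ∀ u, d u * affFun a x u = affFun a x' u := by
  constructor
  · intro hd x
    exact ⟨_, IsAffineFrame.mul_affFun d hd x⟩
  · intro hd u i hui
    -- The test function is the `i`-th barycentric coordinate: its product with `d` has value `d (v
    -- i)` at `v i` and zero at the rest of the frame, so it must be `d (v i)` times that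
    -- coordinate.
    obtain ⟨x', hx'⟩ := hd (Pi.single i 1)
    have h1 : x' = Pi.single i (d (v i)) := by
      ext j
      rw [← h.affFun_frame x' j, ← hx', h.affFun_frame]
      rcases eq_or_ne j i with rfl | hj
      · simp
      · simp [hj]
    have h2 := hx' u
    rw [h1] at h2
    simp only [affFun_apply, Pi.single_apply, mul_ite, mul_one, mul_zero, Finset.sum_ite_eq',
      Finset.mem_univ, if_true] at h2
    rw [mul_comm] at h2
    exact mul_left_cancel₀ hui h2

variable (k) in
/-- The lattice spanned by the differences along the edges. -/
def edgeLattice (a : ι → I → ℤ) : AddSubgroup (I → ℤ) :=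
  AddSubgroup.closure {m | ∃ u i, (a u i : k) ≠ 0 ∧ m = a u - Pi.single i 1}

theorem IsAffineFrame.mul_affFun_mem_embTangent (h : IsAffineFrame a v) {y : ℙ k (ι → k)}
    (hy : y ∈ toricClosure k a) (x : I → k) :
    (fun u => y.rep u * affFun a x u) ∈ embTangent (toricClosure k a) y := by
  rw [h.mem_embTangent_iff]
  intro α β hαβ
  rw [dmon_mul, dmon_mul, h.vpow_eq hy hαβ, sum_mul_affFun, sum_mul_affFun, hαβ]

/-- When `y u = 0`, every partial derivative other than the one in direction `u` keeps the factor `y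
u`. This evaluates tangent equations at points outside the torus. -/
theorem dmon_single_add_of_eq_zero {u : ι} {y : ι → k} (hu : y u = 0) {γ : ι →₀ ℕ}
    (hγ : vpow y γ ≠ 0) (w : ι → k) :
    dmon (Finsupp.single u 1 + γ) y w = vpow y γ * w u := by
  classical
  have hγu : γ u = 0 := by
    by_contra h0
    exact (vpow_ne_zero_iff _ _).1 hγ u h0 hu
  rw [dmon, Finset.sum_eq_single u]
  · simp [hγu]
  · intro u' _ hu'
    have : vpow y (Finsupp.single u 1 + γ - Finsupp.single u' 1) = 0 := by
      by_contra h0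
      refine (vpow_ne_zero_iff _ _).1 h0 u ?_ hu
      simp [hu'.symm]
    simp [this]
  · simp

/-- `u` and `u'` differ, up to a weight that does not change, by monomials that are nonzero
at `y`. -/
def MonomialRelated (a : ι → I → ℤ) (y : ι → k) (u u' : ι) : Prop :=
  ∃ γ γ' : ι →₀ ℕ, a u + weight a γ = a u' + weight a γ' ∧ vpow y γ ≠ 0 ∧ vpow y γ' ≠ 0

theorem MonomialRelated.refl (y : ι → k) (u : ι) : MonomialRelated a y u u :=
  ⟨0, 0, rfl, by simp [vpow_zero], by simp [vpow_zero]⟩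

theorem MonomialRelated.symm {y : ι → k} {u u' : ι} (h : MonomialRelated a y u u') :
    MonomialRelated a y u' u := by
  obtain ⟨γ, γ', h1, h2, h3⟩ := h
  exact ⟨γ', γ, h1.symm, h3, h2⟩

theorem MonomialRelated.trans {y : ι → k} {u u' u'' : ι} (h : MonomialRelated a y u u')
    (h' : MonomialRelated a y u' u'') : MonomialRelated a y u u'' := by
  obtain ⟨γ, γ', h1, h2, h3⟩ := h
  obtain ⟨δ, δ', h4, h5, h6⟩ := h'
  refine ⟨γ + δ, δ' + γ', ?_, ?_, ?_⟩
  · rw [weight_add, weight_add, ← add_assoc, h1, add_right_comm, h4, add_assoc]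
  · rw [vpow_add]
    exact mul_ne_zero h2 h5
  · rw [vpow_add]
    exact mul_ne_zero h6 h3

variable {x y : ℙ k (ι → k)}

/-- A diagonal operator that carries the tangent space at `x` into the equal one at `y` preserves
affine functions after division by `x`. -/
theorem IsAffineFrame.mem_embTangent_of_eq (h : IsAffineFrame a v) (hx : x ∈ toricClosure k a)
    (hx0 : ∀ u, x.rep u ≠ 0)
    (hxy : embTangent (toricClosure k a) y = embTangent (toricClosure k a) x) {d : ι → k}
    (hd : ∀ f : I → k, (fun u => x.rep u * (d u * affFun a f u)) ∈
      embTangent (toricClosure k a) y) : EdgeInvariant a v d := by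
  rw [h.edgeInvariant_iff]
  intro f
  have h1 := hd f
  rw [hxy, h.mem_embTangent_iff_of_ne_zero hx hx0] at h1
  obtain ⟨x', hx'⟩ := h1
  exact ⟨x', fun u => mul_left_cancel₀ (hx0 u) (hx' u)⟩

theorem IsAffineFrame.edgeInvariant_quotient (h : IsAffineFrame a v) (hx : x ∈ toricClosure k a)
    (hx0 : ∀ u, x.rep u ≠ 0) (hy : y ∈ toricClosure k a)
    (hxy : embTangent (toricClosure k a) y = embTangent (toricClosure k a) x) :
    EdgeInvariant a v fun u => (x.rep u)⁻¹ * y.rep u := by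
  refine h.mem_embTangent_of_eq hx hx0 hxy fun f => ?_
  convert h.mul_affFun_mem_embTangent hy f using 2 with u
  rw [← mul_assoc, mul_inv_cancel_left₀ (hx0 u)]

theorem exists_of_dmon_summand_ne_zero {α : ι →₀ ℕ} {y : ι → k} {u : ι} {c : k}
    (h : (α u : k) * vpow y (α - Finsupp.single u 1) * c ≠ 0) :
    ∃ γ, α = Finsupp.single u 1 + γ ∧ vpow y γ ≠ 0 := by
  refine ⟨α - Finsupp.single u 1, ?_, right_ne_zero_of_mul (left_ne_zero_of_mul h)⟩
  have h0 : α u ≠ 0 := by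
    intro h0
    simp [h0] at h
  rw [add_tsub_cancel_of_le]
  rw [Finsupp.single_le_iff]
  exact Nat.one_le_iff_ne_zero.2 h0

theorem dmon_mul_left {α : ι →₀ ℕ} {y d w : ι → k} {c : k}
    (h : ∀ u γ, α = Finsupp.single u 1 + γ → vpow y γ ≠ 0 → d u = c) :
    dmon α y (fun u => d u * w u) = c * dmon α y w := by
  rw [dmon, dmon, Finset.mul_sum]
  refine Finset.sum_congr rfl fun u _ => ?_
  by_cases h0 : (α u : k) * vpow y (α - Finsupp.single u 1) * w u = 0
  · rw [h0, mul_left_comm, h0, mul_zero, mul_zero]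
  · obtain ⟨γ, h1, h2⟩ := exists_of_dmon_summand_ne_zero h0
    rw [h u γ h1 h2]
    ring

/-- Each tangent equation at `y` involves only coordinates that are related to each other. So the
projection to one class of related coordinates preserves the tangent space at `y`, which is that at
`x`; its indicator is then edge invariant, and no edge leaves the class. -/
theorem IsAffineFrame.monomialRelated (h : IsAffineFrame a v) (hx : x ∈ toricClosure k a)
    (hx0 : ∀ u, x.rep u ≠ 0)
    (hxy : embTangent (toricClosure k a) y = embTangent (toricClosure k a) x) {u : ι} {i : I}
    (hui : (a u i : k) ≠ 0) : MonomialRelated a y.rep u (v i) := by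
  classical
  let d : ι → k := fun u' => if MonomialRelated a y.rep u u' then 1 else 0
  have hd : EdgeInvariant a v d := by
    refine h.mem_embTangent_of_eq hx hx0 hxy fun f => ?_
    have hf : (fun u => x.rep u * affFun a f u) ∈ embTangent (toricClosure k a) y := by
      rw [hxy]
      exact h.mul_affFun_mem_embTangent hx f
    rw [h.mem_embTangent_iff] at hf ⊢
    intro α β hαβ
    have hcomm : (fun u => x.rep u * (d u * affFun a f u)) =
        fun u => d u * (x.rep u * affFun a f u) := by
      ext u
      ring
    rw [hcomm]
    -- All coordinates that contribute to either side of one tangent equation are related, so `d` is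
    -- constant on the equation and can be factored out.
    have hrel : ∀ α β : ι →₀ ℕ, weight a α = weight a β → ∀ u₁ γ₁ u₂ γ₂,
        α = Finsupp.single u₁ 1 + γ₁ → vpow y.rep γ₁ ≠ 0 →
        β = Finsupp.single u₂ 1 + γ₂ → vpow y.rep γ₂ ≠ 0 → d u₁ = d u₂ := by
      intro α β hαβ u₁ γ₁ u₂ γ₂ h1 h2 h3 h4
      have h5 : MonomialRelated a y.rep u₁ u₂ := by
        refine ⟨γ₁, γ₂, ?_, h2, h4⟩
        rw [h1, h3] at hαβ
        simpa [weight_add, weight_single] using hαβ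
      have h6 : MonomialRelated a y.rep u u₁ ↔ MonomialRelated a y.rep u u₂ :=
        ⟨fun h => h.trans h5, fun h => h.trans h5.symm⟩
      simp only [d, h6]
    by_cases hex : ∃ u₁ γ₁, α = Finsupp.single u₁ 1 + γ₁ ∧ vpow y.rep γ₁ ≠ 0
    · obtain ⟨u₁, γ₁, h1, h2⟩ := hex
      rw [dmon_mul_left (c := d u₁) fun u₂ γ₂ h3 h4 => hrel α α rfl u₂ γ₂ u₁ γ₁ h3 h4 h1 h2,
        dmon_mul_left (c := d u₁) fun u₂ γ₂ h3 h4 => hrel β α hαβ.symm u₂ γ₂ u₁ γ₁ h3 h4 h1 h2,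
        hf α β hαβ]
    · push Not at hex
      rw [dmon_mul_left (c := 0) fun u₂ γ₂ h3 h4 => absurd (hex u₂ γ₂ h3) h4]
      by_cases hex' : ∃ u₁ γ₁, β = Finsupp.single u₁ 1 + γ₁ ∧ vpow y.rep γ₁ ≠ 0
      · obtain ⟨u₁, γ₁, h1, h2⟩ := hex'
        rw [dmon_mul_left (c := d u₁) fun u₂ γ₂ h3 h4 => hrel β β rfl u₂ γ₂ u₁ γ₁ h3 h4 h1 h2,
          ← hf α β hαβ]
        have h0 : dmon α y.rep (fun u => x.rep u * affFun a f u) = 0 := by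
          rw [dmon]
          refine Finset.sum_eq_zero fun u' _ => ?_
          by_contra hne
          obtain ⟨γ, h3, h4⟩ := exists_of_dmon_summand_ne_zero hne
          exact h4 (hex u' γ h3)
        rw [h0, zero_mul, mul_zero]
      · push Not at hex'
        rw [dmon_mul_left (c := 0) fun u₂ γ₂ h3 h4 => absurd (hex' u₂ γ₂ h3) h4, zero_mul, zero_mul]
  have h2 := hd u i hui
  simp only [d, MonomialRelated.refl, if_true] at h2
  by_contra h3
  rw [if_neg h3] at h2
  exact one_ne_zero h2

/-- A point with the same embedded tangent space as the point `x` of the torus satisfies, relative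
to `x`, the binomial equations given by the edges. -/
theorem IsAffineFrame.exists_vpow_eq_of_edge (h : IsAffineFrame a v) (hx : x ∈ toricClosure k a)
    (hx0 : ∀ u, x.rep u ≠ 0) (hy : y ∈ toricClosure k a)
    (hxy : embTangent (toricClosure k a) y = embTangent (toricClosure k a) x) {u : ι} {i : I}
    (hui : (a u i : k) ≠ 0) : ∃ γ γ' : ι →₀ ℕ, a u + weight a γ = Pi.single i 1 + weight a γ' ∧
      vpow (fun u => (x.rep u)⁻¹ * y.rep u) γ = vpow (fun u => (x.rep u)⁻¹ * y.rep u) γ' ∧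
      vpow (fun u => (x.rep u)⁻¹ * y.rep u) γ ≠ 0 := by
  have hz := h.edgeInvariant_quotient hx hx0 hy hxy u i hui
  rw [← h.frame i]
  -- If `y u` vanishes, so does `y (v i)`, and the equation `z u = z (v i)` cannot be used to cancel
  -- anything; nonvanishing monomials `γ`, `γ'` with the same difference of weights replace it.
  by_cases hu : y.rep u = 0
  · have hvi : y.rep (v i) = 0 := by
      simpa [hu, hx0] using hz.symm
    obtain ⟨γ, γ', h1, h2, h3⟩ := h.monomialRelated hx hx0 hxy hui
    refine ⟨γ, γ', h1, ?_, ?_⟩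
    · have hw : weight a (Finsupp.single u 1 + γ) = weight a (Finsupp.single (v i) 1 + γ') := by
        simpa [weight_add, weight_single] using h1
      have h4 := h.vpow_eq hx hw
      -- Taking the constant function `1`, the vector `x` itself is tangent at `x`, hence at `y`.
      -- The tangent equation at `y` evaluated on it compares `y ^ γ` with `y ^ γ'`.
      have h5 : x.rep ∈ embTangent (toricClosure k a) y := by
        rw [hxy]
        have := h.mul_affFun_mem_embTangent hx (fun _ => 1)
        rw [h.affFun_const] at this
        simpa using this
      have h6 := h.mem_embTangent_iff.1 h5 _ _ hw
      rw [dmon_single_add_of_eq_zero hu h2, dmon_single_add_of_eq_zero hvi h3] at h6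
      rw [vpow_mul, vpow_mul]
      simp only [vpow_add, vpow_single, pow_one] at h4
      have h7 : ∀ γ : ι →₀ ℕ, vpow (fun u => (x.rep u)⁻¹) γ = (vpow x.rep γ)⁻¹ := fun γ => by
        simp [vpow]
      have h8 : ∀ γ, vpow x.rep γ ≠ 0 := fun γ => (vpow_ne_zero_iff _ _).2 fun u _ => hx0 u
      rw [h7, h7, inv_mul_eq_div, inv_mul_eq_div, div_eq_div_iff (h8 _) (h8 _)]
      refine mul_left_cancel₀ (mul_ne_zero (hx0 u) (hx0 (v i))) ?_
      linear_combination (x.rep (v i) * vpow x.rep γ') * h6 - x.rep (v i) * vpow y.rep γ' * h4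
    · rw [vpow_mul]
      exact mul_ne_zero ((vpow_ne_zero_iff _ _).2 fun u _ => inv_ne_zero (hx0 u)) h2
  -- The identity of weights is trivial here; the content is `z u = z (v i) ≠ 0`.
  · refine ⟨Finsupp.single (v i) 1, Finsupp.single u 1, ?_, ?_, ?_⟩
    · simp [weight_single, add_comm]
    · simpa [vpow_single] using hz.symm
    · rw [vpow_single, pow_one]
      exact fun h0 => mul_ne_zero (inv_ne_zero (hx0 u)) hu (hz.trans h0)

theorem IsAffineFrame.vpow_quotient_eq (h : IsAffineFrame a v) (hx : x ∈ toricClosure k a)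
    (hy : y ∈ toricClosure k a) {α β : ι →₀ ℕ} (hαβ : weight a α = weight a β) :
    vpow (fun u => (x.rep u)⁻¹ * y.rep u) α = vpow (fun u => (x.rep u)⁻¹ * y.rep u) β := by
  have h7 : ∀ γ : ι →₀ ℕ, vpow (fun u => (x.rep u)⁻¹) γ = (vpow x.rep γ)⁻¹ := fun γ => by
    simp [vpow]
  rw [vpow_mul, vpow_mul, h7, h7, h.vpow_eq hx hαβ, h.vpow_eq hy hαβ]

theorem IsAffineFrame.vpow_eq_of_mem_edgeLattice (h : IsAffineFrame a v)
    (hx : x ∈ toricClosure k a) (hx0 : ∀ u, x.rep u ≠ 0) (hy : y ∈ toricClosure k a)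
    (hxy : embTangent (toricClosure k a) y = embTangent (toricClosure k a) x)
    {α β : ι →₀ ℕ} (hαβ : weight a α - weight a β ∈ edgeLattice k a) :
    vpow (fun u => (x.rep u)⁻¹ * y.rep u) α = vpow (fun u => (x.rep u)⁻¹ * y.rep u) β := by
  set z : ι → k := fun u => (x.rep u)⁻¹ * y.rep u with hz
  -- Every element of the lattice is a difference of weights of monomials that agree and do not
  -- vanish at `z`. Nonvanishing is what permits the cancellation at the end.
  have key : ∀ m ∈ edgeLattice k a, ∃ γ γ' : ι →₀ ℕ, weight a γ' - weight a γ = m ∧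
      vpow z γ = vpow z γ' ∧ vpow z γ ≠ 0 := by
    intro m hm
    induction hm using AddSubgroup.closure_induction with
    | mem m hm =>
      obtain ⟨u, i, hui, rfl⟩ := hm
      obtain ⟨γ, γ', h1, h2, h3⟩ := h.exists_vpow_eq_of_edge hx hx0 hy hxy hui
      refine ⟨γ, γ', ?_, h2, h3⟩
      rw [sub_eq_sub_iff_add_eq_add, add_comm, ← h1, add_comm]
    | zero => exact ⟨0, 0, by simp, rfl, by simp [vpow_zero]⟩
    | add m m' _ _ hm hm' =>
      obtain ⟨γ, γ', h1, h2, h3⟩ := hm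
      obtain ⟨δ, δ', h4, h5, h6⟩ := hm'
      refine ⟨γ + δ, γ' + δ', ?_, ?_, ?_⟩
      · rw [weight_add, weight_add, ← h1, ← h4]
        abel
      · rw [vpow_add, vpow_add, h2, h5]
      · rw [vpow_add]
        exact mul_ne_zero h3 h6
    | neg m _ hm =>
      obtain ⟨γ, γ', h1, h2, h3⟩ := hm
      exact ⟨γ', γ, by rw [← h1]; abel, h2.symm, h2 ▸ h3⟩
  obtain ⟨γ, γ', h1, h2, h3⟩ := key _ hαβ
  have h4 : weight a (α + γ) = weight a (β + γ') := by
    rw [weight_add, weight_add, add_comm (weight a β), ← sub_eq_sub_iff_add_eq_add, h1]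
  have h5 := h.vpow_quotient_eq hx hy h4
  rw [vpow_add, vpow_add, ← hz, ← h2] at h5
  exact mul_right_cancel₀ h3 h5

/-- Injectivity of Frobenius extracts the `p`-th root of the equation; this reflects that the fibers
are taken with reduced structure. -/
theorem IsAffineFrame.vpow_eq_of_nsmul_mem_edgeLattice (h : IsAffineFrame a v)
    (hx : x ∈ toricClosure k a) (hx0 : ∀ u, x.rep u ≠ 0) (hy : y ∈ toricClosure k a)
    (hxy : embTangent (toricClosure k a) y = embTangent (toricClosure k a) x)
    (p : ℕ) [CharP k p] [Fact p.Prime]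
    {α β : ι →₀ ℕ} (hαβ : p • (weight a α - weight a β) ∈ edgeLattice k a) :
    vpow (fun u => (x.rep u)⁻¹ * y.rep u) α = vpow (fun u => (x.rep u)⁻¹ * y.rep u) β := by
  have h1 := h.vpow_eq_of_mem_edgeLattice hx hx0 hy hxy (α := p • α) (β := p • β) (by
    rwa [weight_nsmul, weight_nsmul, ← smul_sub])
  rw [vpow_nsmul, vpow_nsmul] at h1
  exact frobenius_inj k p h1

end Fibers

end ToricGauss

namespace ToricGauss

open MvPolynomial

/-! ### Irreducible components of a finite union of irreducible sets. -/

section Topology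

variable {Y J : Type*} [TopologicalSpace Y] {G : Set Y} {Z : J → Set Y}

theorem isIrreducible_preimage_val {S : Set Y} (hS : IsIrreducible S) (hSG : S ⊆ G) :
    IsIrreducible (Subtype.val ⁻¹' S : Set G) := by
  obtain ⟨⟨y, hy⟩, hS'⟩ := hS
  refine ⟨⟨⟨y, hSG hy⟩, hy⟩, ?_⟩
  rintro _ _ ⟨U, hU, rfl⟩ ⟨V, hV, rfl⟩ ⟨⟨u, _⟩, hu, hu'⟩ ⟨⟨w, _⟩, hw, hw'⟩
  obtain ⟨x, hx, hxU, hxV⟩ := hS' U V hU hV ⟨u, hu, hu'⟩ ⟨w, hw, hw'⟩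
  exact ⟨⟨x, hSG hx⟩, hx, hxU, hxV⟩

theorem closure_image_preimage_closure {S : Set Y} (hSG : S ⊆ G) :
    closure (Subtype.val '' (Subtype.val ⁻¹' closure S : Set G)) = closure S := by
  apply Set.Subset.antisymm
  · refine closure_minimal ?_ isClosed_closure
    rintro _ ⟨y, hy, rfl⟩
    exact hy
  · exact closure_mono fun y hy => ⟨⟨y, hSG hy⟩, subset_closure hy, rfl⟩

theorem isIrreducible_preimage_closure {S : Set Y} (hS : IsIrreducible S) (hSG : S ⊆ G) :
    IsIrreducible (Subtype.val ⁻¹' closure S : Set G) := by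
  have : (Subtype.val ⁻¹' closure S : Set G) = closure (Subtype.val ⁻¹' S : Set G) := by
    rw [Topology.IsInducing.subtypeVal.closure_eq_preimage_closure_image,
      Subtype.image_preimage_coe, Set.inter_eq_right.2 hSG]
  rw [this]
  exact (isIrreducible_preimage_val hS hSG).closure

/-- The irreducible components of a union of finitely many irreducible sets that are not contained
in the closures of each other. -/
theorem irreducibleComponents_eq_range [Finite J] (hZ : ∀ j, IsIrreducible (Z j))
    (hZG : ∀ j, Z j ⊆ G) (hG : G ⊆ ⋃ j, closure (Z j))
    (hne : ∀ i j, Z i ⊆ closure (Z j) → i = j) :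
    irreducibleComponents G = Set.range fun j => (Subtype.val ⁻¹' closure (Z j) : Set G) := by
  classical
  cases nonempty_fintype J
  have hirr := fun j => isIrreducible_preimage_closure (hZ j) (hZG j)
  have hsub : ∀ S : Set G, IsIrreducible S → ∃ j, S ⊆ Subtype.val ⁻¹' closure (Z j) := by
    intro S hS
    obtain ⟨T, hT, hST⟩ := isIrreducible_iff_sUnion_isClosed.1 hS
      (Finset.univ.image fun j => (Subtype.val ⁻¹' closure (Z j) : Set G)) (by
        intro T hT
        obtain ⟨j, -, rfl⟩ := Finset.mem_image.1 hT
        exact isClosed_closure.preimage continuous_subtype_val) (by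
        intro y _
        obtain ⟨j, hj⟩ := Set.mem_iUnion.1 (hG y.2)
        exact ⟨_, Finset.mem_image_of_mem _ (Finset.mem_univ j), hj⟩)
    obtain ⟨j, -, rfl⟩ := Finset.mem_image.1 hT
    exact ⟨j, hST⟩
  have hmono : ∀ i j, (Subtype.val ⁻¹' closure (Z i) : Set G) ⊆ Subtype.val ⁻¹' closure (Z j) →
      i = j := fun i j hij => hne i j fun y hy => hij (a := ⟨y, hZG i hy⟩) (subset_closure hy)
  ext S
  constructor
  · intro hS
    obtain ⟨j, hj⟩ := hsub S hS.1
    exact ⟨j, (hj.antisymm (hS.2 (hirr j) hj)).symm⟩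
  · rintro ⟨i, rfl⟩
    refine ⟨hirr i, fun T hT hiT => ?_⟩
    obtain ⟨j, hj⟩ := hsub T hT
    obtain rfl := hmono i j (hiT.trans hj)
    exact hj

theorem ncard_irreducibleComponents [Finite J] (hZ : ∀ j, IsIrreducible (Z j))
    (hZG : ∀ j, Z j ⊆ G) (hG : G ⊆ ⋃ j, closure (Z j))
    (hne : ∀ i j, Z i ⊆ closure (Z j) → i = j) :
    (irreducibleComponents G).ncard = Nat.card J := by
  rw [irreducibleComponents_eq_range hZ hZG hG hne, ← Set.image_univ, Set.ncard_image_of_injective,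
    Set.ncard_univ]
  intro i j hij
  refine hne i j fun y hy => ?_
  have : (⟨y, hZG i hy⟩ : G) ∈ (Subtype.val ⁻¹' closure (Z j) : Set G) :=
    (Set.ext_iff.1 hij _).1 (subset_closure hy)
  exact this

end Topology

/-! ### Components of the fibers of the Gauss map. -/

section Components

variable {k : Type*} [Field k] {ι I : Type*} [Fintype ι] [Fintype I]
  [DecidableEq I] [Nonempty ι] {a : ι → I → ℤ} {v : I → ι}

theorem torusPt_smul (c : kˣ) (x : ι → kˣ) : torusPt (fun u => c * x u) = torusPt x := by
  rw [torusPt, torusPt, Projectivization.mk_eq_mk_iff]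
  exact ⟨c, by ext u; simp [Units.smul_def]⟩

theorem exists_rep_torusPt (x : ι → kˣ) :
    ∃ c : kˣ, ∀ u, (torusPt x).rep u = ((c * x u : kˣ) : k) := by
  obtain ⟨c, hc⟩ := Projectivization.exists_smul_eq_mk_rep k _ (coe_units_ne_zero x)
  exact ⟨c, fun u => by rw [torusPt, ← hc]; rfl⟩

variable {M : Type*} [AddCommGroup M] (π : (I → ℤ) →+ M) (δ : (I → ℤ) →+ ℤ)

/-- The part of the fiber of the Gauss map that corresponds to the root of unity `ζ`. -/
def fiberPart (a : ι → I → ℤ) (x : ι → kˣ) (ζ : kˣ) : Set (ℙ k (ι → k)) :=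
  orbitSet (fun u => x u * ζ ^ δ (a u)) fun u => evalChar (π (a u))

/-- The conditions on the projection `π` of the character lattice and on the homomorphism `δ` under
which they describe the fibers of the Gauss map. -/
structure IsFiberFrame (k : Type*) [Field k] (a : ι → I → ℤ) (π : (I → ℤ) →+ M)
    (δ : (I → ℤ) →+ ℤ) (c p : ℕ) : Prop where
  map_edge : ∀ u i, (a u i : k) ≠ 0 → π (a u) = π (Pi.single i 1)
  dvd_edge : ∀ u i, (a u i : k) ≠ 0 → (c : ℤ) ∣ δ (a u) - δ (Pi.single i 1)
  nsmul_mem : ∀ m : I → ℤ, ∑ i, m i = 0 → π m = 0 → (c : ℤ) ∣ δ m → p • m ∈ edgeLattice k a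
  exists_eq_one : ∃ m : I → ℤ, ∑ i, m i = 0 ∧ π m = 0 ∧ δ m = 1

variable {π δ} {c p : ℕ}

theorem zpow_eq_of_dvd {ζ : kˣ} (hζ : ζ ^ c = 1) {m m' : ℤ} (h : (c : ℤ) ∣ m - m') :
    ζ ^ m = ζ ^ m' := by
  obtain ⟨e, he⟩ := h
  rw [← sub_add_cancel m m', he, zpow_add, zpow_mul, zpow_natCast, hζ, one_zpow, one_mul]

theorem vpow_zpow (ζ : kˣ) (α : ι →₀ ℕ) :
    vpow (fun u => ζ ^ δ (a u)) α = ζ ^ δ (weight a α) := by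
  have h := map_prod (zpowersHom kˣ ζ) (fun u => Multiplicative.ofAdd (α u • δ (a u))) Finset.univ
  rw [← ofAdd_sum] at h
  rw [vpow, map_weight, weight]
  refine Eq.trans (Finset.prod_congr rfl fun u _ => ?_) h.symm
  simp [← zpow_natCast, ← zpow_mul, mul_comm]

variable [Infinite k]

theorem IsAffineFrame.embTangent_eq_of_edgeInvariant (h : IsAffineFrame a v) {x y : ℙ k (ι → k)}
    (hx : x ∈ toricClosure k a) (hx0 : ∀ u, x.rep u ≠ 0) (hy : y ∈ toricClosure k a)
    (hy0 : ∀ u, y.rep u ≠ 0) {g : ι → k} (hg : EdgeInvariant a v g)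
    (hxy : ∀ u, y.rep u = x.rep u * g u) :
    embTangent (toricClosure k a) y = embTangent (toricClosure k a) x := by
  have hg0 : ∀ u, g u ≠ 0 := fun u h0 => hy0 u (by rw [hxy, h0, mul_zero])
  have hg' : EdgeInvariant a v fun u => (g u)⁻¹ := fun u i hui => congrArg _ (hg u i hui)
  ext w
  rw [h.mem_embTangent_iff_of_ne_zero hx hx0, h.mem_embTangent_iff_of_ne_zero hy hy0]
  constructor
  · rintro ⟨f, hf⟩
    refine ⟨fun i => g (v i) * f i, fun u => ?_⟩
    rw [hf, ← IsAffineFrame.mul_affFun g hg f, hxy]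
    ring
  · rintro ⟨f, hf⟩
    refine ⟨fun i => (g (v i))⁻¹ * f i, fun u => ?_⟩
    rw [hf, ← IsAffineFrame.mul_affFun _ hg' f, hxy, mul_assoc, mul_inv_cancel_left₀ (hg0 u)]

/-- Both `π ∘ a` and the class of `δ ∘ a` modulo `c` are constant along edges, so the quotient of
the two points is edge invariant. -/
theorem IsFiberFrame.fiberPart_subset (hF : IsFiberFrame k a π δ c p) (h : IsAffineFrame a v)
    (x : smoothLocus (toricClosure k a)) (xu : ι → kˣ) (hxu : ∀ u, x.1.rep u = xu u) {ζ : kˣ}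
    (hζ : ζ ^ c = 1) : fiberPart π δ a xu ζ ⊆ gaussFiber (toricClosure k a) x := by
  rintro _ ⟨s, rfl⟩
  have hx0 : ∀ u, x.1.rep u ≠ 0 := fun u => by simp [hxu]
  obtain ⟨t, ht⟩ := h.exists_character x.2.1 hx0
  have hxt : ∀ u, xu u = evalChar (a u) t := fun u => Units.ext (by rw [← hxu, ht])
  have hmem : torusPt (fun u => xu u * ζ ^ δ (a u) * evalChar (π (a u)) s) ∈
      toricClosure k a := by
    refine subset_closure ⟨t * (zpowersHom kˣ ζ).comp (AddMonoidHom.toMultiplicative δ) *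
      s.comp (AddMonoidHom.toMultiplicative π), ?_⟩
    refine congrArg torusPt (funext fun u => ?_)
    simp [hxt, evalChar]
  have hne := torusPt_mem_nonzeroLocus (fun u => xu u * ζ ^ δ (a u) * evalChar (π (a u)) s)
  refine ⟨⟨_, h.mem_smoothLocus hmem hne⟩, ?_, rfl⟩
  obtain ⟨e, he⟩ := exists_rep_torusPt (fun u => xu u * ζ ^ δ (a u) * evalChar (π (a u)) s)
  refine Subtype.ext (h.embTangent_eq_of_edgeInvariant x.2.1 hx0 hmem hne
    (g := fun u => ((e * ζ ^ δ (a u) * evalChar (π (a u)) s : kˣ) : k)) ?_ fun u => ?_)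
  · intro u i hui
    simp only [h.frame]
    rw [hF.map_edge u i hui, zpow_eq_of_dvd hζ (hF.dvd_edge u i hui)]
  · rw [he, hxu, ← Units.val_mul]
    congr 1
    simp only [mul_left_comm, mul_assoc]

variable [Module.Free ℤ M]

/-- A binomial that is invariant under scalars, under the torus of `M` and under the `c`-th roots of
unity has a difference of weights as in `nsmul_mem`. So all points of the fiber satisfy it and lie
in the closure of the orbit of the product group. -/
theorem IsFiberFrame.gaussFiber_subset [CharP k p] [Fact p.Prime] [NeZero c]
    (hF : IsFiberFrame k a π δ c p) (h : IsAffineFrame a v)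
    (x : smoothLocus (toricClosure k a)) (xu : ι → kˣ) (hxu : ∀ u, x.1.rep u = xu u) {ω : kˣ}
    (hω : IsPrimitiveRoot ω c) :
    gaussFiber (toricClosure k a) x ⊆
      ⋃ ζ : rootsOfUnity c k, closure (fiberPart π δ a xu ζ) := by
  rintro _ ⟨y, hy, rfl⟩
  have hx0 : ∀ u, x.1.rep u ≠ 0 := fun u => by simp [hxu]
  have hxy : embTangent (toricClosure k a) y.1 = embTangent (toricClosure k a) x.1 :=
    congrArg Subtype.val hy
  let χ : ι → kˣ × (Multiplicative M →* kˣ) × rootsOfUnity c k →* kˣ := fun u => MonoidHom.fst _ _ *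
    (evalChar (π (a u))).comp ((MonoidHom.fst _ _).comp (MonoidHom.snd _ _)) *
    ((zpowGroupHom (δ (a u))).comp (rootsOfUnity c k).subtype).comp
      ((MonoidHom.snd _ _).comp (MonoidHom.snd _ _))
  have hχ : ∀ u e s ζ, χ u (e, s, ζ) = e * evalChar (π (a u)) s * (ζ : kˣ) ^ δ (a u) :=
    fun _ _ _ _ => rfl
  have hchar : ∀ (α : ι →₀ ℕ) (e : kˣ) (s : Multiplicative M →* kˣ) (ζ : rootsOfUnity c k),
      charOf χ α (e, s, ζ) = e ^ α.degree * evalChar (π (weight a α)) s * (ζ : kˣ) ^ δ (weight a α) := by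
    intro α e s ζ
    rw [charOf_apply]
    simp only [hχ]
    rw [vpow_mul (fun u => e * evalChar (π (a u)) s), vpow_mul (fun _ => e), vpow_zpow]
    congr 2
    · rw [vpow, Finset.prod_pow_eq_pow_sum, Finsupp.degree_eq_sum]
    · rw [← charOf_apply (fun u => evalChar (π (a u))), charOf_evalChar, map_weight π]
  have hclos : y.1 ∈ closure
      (orbitSet (G := kˣ × (Multiplicative M →* kˣ) × rootsOfUnity c k) xu χ) := by
    refine mem_closure_orbitSet _ _ _ fun α β hαβ => ?_
    simp only [Units.val_inv_eq_inv_val, ← hxu]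
    refine h.vpow_eq_of_nsmul_mem_edgeLattice x.2.1 hx0 y.2.1 hxy p (hF.nsmul_mem _ ?_ ?_ ?_)
    · have hdeg : (α.degree : ℤ) - β.degree = 0 := by
        by_contra hne
        obtain ⟨z, hz⟩ := exists_units_zpow_ne_one (k := k) _ hne
        have h1 := DFunLike.congr_fun hαβ (z, 1, 1)
        rw [hchar, hchar] at h1
        refine hz ?_
        rw [zpow_sub, zpow_natCast, zpow_natCast, mul_inv_eq_one]
        simpa using h1
      simp only [Pi.sub_apply, Finset.sum_sub_distrib, h.sum_weight, hdeg]
    · rw [map_sub, sub_eq_zero]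
      refine eq_of_forall_character_eq (k := k) fun s => ?_
      have h1 := DFunLike.congr_fun hαβ (1, s, 1)
      rw [hchar, hchar] at h1
      simpa [evalChar] using h1
    · have h1 := DFunLike.congr_fun hαβ (1, 1, ⟨ω, hω.pow_eq_one⟩)
      rw [hchar, hchar] at h1
      rw [map_sub, ← hω.zpow_eq_one_iff_dvd, zpow_sub, ← div_eq_mul_inv, div_eq_one]
      simpa [evalChar] using h1
  -- Scalars do not move points of projective space, so the orbit is the union of the finitely many
  -- parts indexed by roots of unity.
  rw [← closure_iUnion_of_finite]
  refine closure_mono ?_ hclos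
  rintro _ ⟨⟨e, s, ζ⟩, rfl⟩
  refine Set.mem_iUnion.2 ⟨ζ, s, ?_⟩
  refine Eq.trans (torusPt_smul e _).symm ?_
  refine congrArg torusPt (funext fun u => ?_)
  rw [hχ]
  rw [mul_assoc, mul_assoc, mul_comm (evalChar _ _)]
  exact mul_left_comm _ _ _

/-- The Laurent monomial of weight `m` is constant on each part, and its value is proportional to
`ζ` since `δ m = 1`. Clearing denominators gives a form that separates the parts. -/
theorem IsFiberFrame.eq_of_subset_closure (hF : IsFiberFrame k a π δ c p)
    (h : IsAffineFrame a v) (xu : ι → kˣ) {ζ ζ' : kˣ}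
    (hsub : fiberPart π δ a xu ζ ⊆ closure (fiberPart π δ a xu ζ')) : ζ = ζ' := by
  obtain ⟨m, hm0, hmπ, hmδ⟩ := hF.exists_eq_one
  set α := posExp v m with hα
  set β := posExp v (-m) with hβ
  have hαβ : weight a α - weight a β = m := h.weight_posExp_sub m
  have hdeg : β.degree = α.degree := by
    have h1 := h.sum_weight α
    have h2 := h.sum_weight β
    have h3 : ∑ i, (weight a α i - weight a β i) = 0 := by
      rw [← hm0, ← hαβ]
      rfl
    rw [Finset.sum_sub_distrib, h1, h2] at h3
    omega
  let X' : kˣ → ι → kˣ := fun ζ u => xu u * ζ ^ δ (a u)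
  have hX' : ∀ ζ α, vpow (X' ζ) α = vpow xu α * ζ ^ δ (weight a α) := by
    intro ζ α
    rw [vpow_mul, vpow_zpow]
  have hπ : ∀ s : Multiplicative M →* kˣ, vpow (fun u => evalChar (π (a u)) s) α =
      vpow (fun u => evalChar (π (a u)) s) β := by
    intro s
    have : π (weight a α) = π (weight a β) := by
      rw [← sub_eq_zero, ← map_sub, hαβ, hmπ]
    rw [← charOf_apply (fun u => evalChar (π (a u))), ← charOf_apply (fun u => evalChar (π (a u))),
      charOf_evalChar, charOf_evalChar, ← map_weight, ← map_weight, this]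
  let F : MvPolynomial ι k := monomial α ((vpow (X' ζ') β : kˣ) : k) -
    monomial β ((vpow (X' ζ') α : kˣ) : k)
  have hFhom : F.IsHomogeneous α.degree :=
    (isHomogeneous_monomial _ rfl).sub (isHomogeneous_monomial _ hdeg)
  have heval : ∀ z : ι → kˣ, eval (fun u => (z u : k)) F = 0 ↔
      vpow (X' ζ') β * vpow z α = vpow (X' ζ') α * vpow z β := by
    intro z
    rw [map_sub, eval_monomial_eq, eval_monomial_eq, ← coe_vpow, ← coe_vpow, sub_eq_zero,
      ← Units.val_mul, ← Units.val_mul, Units.val_inj]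
  have hmem := hsub ⟨1, rfl⟩
  rw [mem_closure_iff_forms] at hmem
  have h1 := hmem F ⟨⟨_, hFhom⟩, by
    rintro _ ⟨s, rfl⟩
    rw [eval_rep_torusPt_eq_zero_iff hFhom, heval, vpow_mul (X' ζ'), vpow_mul (X' ζ'), hπ]
    rw [mul_left_comm]⟩
  rw [eval_rep_torusPt_eq_zero_iff hFhom, heval, vpow_mul (X' ζ), vpow_mul (X' ζ), hπ] at h1
  have hwt : δ (weight a α) = δ (weight a β) + 1 := by
    rw [← hmδ, ← hαβ, map_sub]
    ring
  simp only [hX', hwt, zpow_add, zpow_one] at h1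
  simp only [← mul_assoc] at h1
  have h2 := mul_right_cancel h1
  have h3 : (vpow xu α * vpow xu β * ζ ^ δ (weight a β) * ζ' ^ δ (weight a β)) * ζ =
      (vpow xu α * vpow xu β * ζ ^ δ (weight a β) * ζ' ^ δ (weight a β)) * ζ' := by
    calc _ = vpow xu β * ζ' ^ δ (weight a β) * vpow xu α * ζ ^ δ (weight a β) * ζ := by
          simp only [mul_left_comm, mul_comm, mul_assoc]
      _ = _ := h2
      _ = _ := by simp only [mul_left_comm, mul_comm, mul_assoc]
  exact mul_left_cancel h3

/-- Each part of a fiber has a closure that is projectively equivalent to the toric variety of the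
projection of the weights. -/
theorem projEquiv_closure_fiberPart (A' : Finset M) (xu : ι → kˣ) (ζ : kˣ)
    (hA' : ∀ u, π (a u) ∈ A') (hsurj : ∀ m ∈ A', ∃ u, π (a u) = m) :
    ProjEquiv (closure (fiberPart π δ a xu ζ)) (toricVariety k A') := by
  obtain ⟨m, hm⟩ : ∃ m, Fintype.card ι = m + 1 :=
    ⟨Fintype.card ι - 1, (Nat.sub_add_cancel Fintype.card_pos).symm⟩
  let e : ι ≃ Fin (m + 1) := Fintype.equivFinOfCardEq hm
  let f : (ι → k) ≃ₗ[k] (Fin (m + 1) → k) := LinearEquiv.funCongrLeft k k e.symm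
  -- Weights with the same projection repeat a coordinate of `X_{A'}` up to a nonzero factor;
  -- surjectivity onto `A'` makes `g` injective.
  let g : (A' → k) →ₗ[k] (ι → k) :=
    { toFun := fun y u => ((xu u * ζ ^ δ (a u) : kˣ) : k) * y ⟨π (a u), hA' u⟩
      map_add' := fun y z => by ext; simp [mul_add]
      map_smul' := fun c y => by ext; simp [mul_left_comm] }
  have hg : Function.Injective g := by
    intro y z hyz
    ext ⟨m, hm⟩
    obtain ⟨u, rfl⟩ := hsurj m hm
    have h1 : ((xu u * ζ ^ δ (a u) : kˣ) : k) * y ⟨π (a u), hA' u⟩ =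
      ((xu u * ζ ^ δ (a u) : kˣ) : k) * z ⟨π (a u), hA' u⟩ := congrFun hyz u
    exact mul_left_cancel₀ (Units.ne_zero _) h1
  refine ⟨m, f.toLinearMap, f.toLinearMap ∘ₗ g, f.injective, f.injective.comp hg, ?_⟩
  have h1 : closure (fiberPart π δ a xu ζ) =
      Projectivization.map g hg '' toricVariety k A' := by
    rw [toricVariety, map_image_closure]
    congr 1
    ext y
    constructor
    · rintro ⟨s, rfl⟩
      have hne : (fun u : A' => (s (Multiplicative.ofAdd (u : M)) : k)) ≠ 0 := fun h0 =>
        (s (Multiplicative.ofAdd (π (a (Classical.arbitrary ι))))).ne_zero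
          (congrFun h0 ⟨_, hA' _⟩)
      refine ⟨_, ⟨s, hne, rfl⟩, ?_⟩
      rw [Projectivization.map_mk]
      rfl
    · rintro ⟨_, ⟨s, hne, rfl⟩, rfl⟩
      refine ⟨s, ?_⟩
      rw [Projectivization.map_mk]
      rfl
  rw [h1, ← Set.image_comp]
  rw [Projectivization.map_comp g hg f.toLinearMap f.injective]

variable [Module.Finite ℤ M]

theorem IsFiberFrame.fiber_components [IsAlgClosed k] [CharP k p] [Fact p.Prime] (hc : 0 < c)
    (hcp : c.Coprime p) (hF : IsFiberFrame k a π δ c p) (h : IsAffineFrame a v) (A' : Finset M)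
    (hA' : ∀ u, π (a u) ∈ A') (hsurj : ∀ m ∈ A', ∃ u, π (a u) = m)
    (x : smoothLocus (toricClosure k a)) (hx0 : ∀ u, x.1.rep u ≠ 0) :
    (∀ F ∈ irreducibleComponents (gaussFiber (toricClosure k a) x),
      ProjEquiv (closure (Subtype.val '' F)) (toricVariety k A')) ∧
    (irreducibleComponents (gaussFiber (toricClosure k a) x)).ncard = c := by
  have : NeZero c := ⟨hc.ne'⟩
  have : NeZero (c : k) := ⟨fun h0 => by
    rw [CharP.cast_eq_zero_iff k p] at h0
    exact (Fact.out : p.Prime).one_lt.ne' (Nat.eq_one_of_dvd_coprimes hcp h0 dvd_rfl)⟩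
  obtain ⟨ω, hω⟩ := HasEnoughRootsOfUnity.exists_primitiveRoot k c
  obtain ⟨ω, rfl⟩ := hω.isUnit hc.ne'
  have hω' : IsPrimitiveRoot ω c := IsPrimitiveRoot.coe_units_iff.1 hω
  let xu : ι → kˣ := fun u => Units.mk0 _ (hx0 u)
  have hxu : ∀ u, x.1.rep u = xu u := fun u => rfl
  let Z : rootsOfUnity c k → Set (ℙ k (ι → k)) := fun ζ => fiberPart π δ a xu ζ
  have h1 : ∀ ζ, IsIrreducible (Z ζ) := fun ζ => isIrreducible_orbitSet _ _
  have h2 : ∀ ζ, Z ζ ⊆ gaussFiber (toricClosure k a) x := fun ζ =>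
    hF.fiberPart_subset h x xu hxu ζ.2
  have h3 := hF.gaussFiber_subset h x xu hxu hω'
  have h4 : ∀ ζ ζ', Z ζ ⊆ closure (Z ζ') → ζ = ζ' := fun ζ ζ' hsub =>
    Subtype.ext (hF.eq_of_subset_closure h xu hsub)
  constructor
  · rw [irreducibleComponents_eq_range h1 h2 h3 h4]
    rintro _ ⟨ζ, rfl⟩
    rw [closure_image_preimage_closure (h2 ζ)]
    exact projEquiv_closure_fiberPart A' xu ζ hA' hsurj
  · rw [ncard_irreducibleComponents h1 h2 h3 h4]
    exact hω.card_rootsOfUnity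

end Components

end ToricGauss

namespace ToricGauss

open MvPolynomial

/-! ### Plücker coordinates in an arbitrary basis. -/

section Plucker

variable {k : Type*} [Field k] {ι : Type*} [Fintype ι]

theorem pluckerVector_eq_det_smul {d : ℕ} (b b' : Fin d → ι → k) (P : Matrix (Fin d) (Fin d) k)
    (h : ∀ i, b' i = ∑ j, P i j • b j) : pluckerVector b' = P.det • pluckerVector b := by
  ext J
  have h1 : (Matrix.of fun i j => b' i (J j)) = P * Matrix.of fun i j => b i (J j) := by
    ext i j
    simp [Matrix.mul_apply, h]
  rw [pluckerVector, h1, Matrix.det_mul]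
  rfl

/-- The Plücker coordinates can be computed from any basis. -/
theorem plucker_eq_mk {d : ℕ} (L : Grassmannian k ι d) (b : Fin d → ι → k)
    (hb : LinearIndependent k b) (hbL : ∀ i, b i ∈ L.1) :
    plucker L = Projectivization.mk k (pluckerVector b) (pluckerVector_ne_zero b hb) := by
  rw [plucker, eq_comm, Projectivization.mk_eq_mk_iff']
  let β := Module.finBasisOfFinrankEq k L.1 L.2
  refine ⟨Matrix.det (Matrix.of fun i j => β.repr ⟨b i, hbL i⟩ j),
    (pluckerVector_eq_det_smul _ _ _ fun i => ?_).symm⟩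
  have h1 := congrArg Subtype.val (β.sum_repr ⟨b i, hbL i⟩)
  rw [Submodule.coe_sum] at h1
  exact h1.symm

end Plucker

/-! ### The rank of the Gauss map. -/

section Rank

variable {k : Type*} [Field k] {ι I : Type*} [Fintype ι] [Fintype I]
  [DecidableEq I] {a : ι → I → ℤ} {v : I → ι}

/-- The matrix of the values of the weights `J j`. -/
def weightMatrix (k : Type*) [Field k] (a : ι → I → ℤ) {d : ℕ} (e : Fin d ≃ I) (J : Fin d → ι) :
    Matrix (Fin d) (Fin d) k :=
  Matrix.of fun i j => (a (J j) (e i) : k)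

/-- The monomials that represent the Gauss map of a toric variety. -/
noncomputable def gaussForm (k : Type*) [Field k] (a : ι → I → ℤ) {d : ℕ} (e : Fin d ≃ I)
    (J : Fin d → ι) : MvPolynomial ι k :=
  monomial (∑ j, Finsupp.single (J j) 1) (weightMatrix k a e J).det

theorem isHomogeneous_gaussForm {d : ℕ} (e : Fin d ≃ I) (J : Fin d → ι) :
    (gaussForm k a e J).IsHomogeneous d := by
  refine isHomogeneous_monomial _ ?_
  simp

theorem eval_gaussForm [Nonempty ι] {d : ℕ} (e : Fin d ≃ I) (J : Fin d → ι) (y : ι → k) :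
    eval y (gaussForm k a e J) = (weightMatrix k a e J).det * ∏ j, y (J j) := by
  simp [gaussForm, eval_monomial_eq, vpow_sum, vpow_single]

theorem polyDifferential_gaussForm [Nonempty ι] [Infinite k] {d : ℕ} (e : Fin d ≃ I)
    (J : Fin d → ι) (y f : ι → k) :
    polyDifferential (gaussForm k a e J) y (fun u => y u * f u) =
      eval y (gaussForm k a e J) * ∑ j, f (J j) := by
  classical
  have h1 : gaussForm k a e J =
      (weightMatrix k a e J).det • monomial (∑ j, Finsupp.single (J j) 1) 1 := by
    rw [smul_monomial, smul_eq_mul, mul_one, gaussForm]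
  rw [h1, polyDifferential_smul, LinearMap.smul_apply, polyDifferential_monomial, dmon_mul,
    smul_eval, eval_monomial_eq, one_mul, smul_eq_mul, mul_assoc]
  congr 2
  simp only [Finsupp.finsetSum_apply, Nat.cast_sum, Finset.sum_mul]
  rw [Finset.sum_comm]
  simp [Finsupp.single_apply]

theorem IsAffineFrame.weightMatrix_frame (h : IsAffineFrame a v) {d : ℕ} (e : Fin d ≃ I) :
    weightMatrix k a e (fun j => v (e j)) = 1 := by
  ext i j
  simp [weightMatrix, h.frame, Matrix.one_apply, Pi.single_apply]

/-- Exchanging one frame element for `u` gives an affinely independent set over `k` exactly when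
there is an edge; this detects edges through Plücker coordinates. -/
theorem IsAffineFrame.det_weightMatrix_update (h : IsAffineFrame a v) {d : ℕ} (e : Fin d ≃ I)
    (i : Fin d) (u : ι) :
    (weightMatrix k a e (Function.update (fun j => v (e j)) i u)).det = a u (e i) := by
  have h1 : weightMatrix k a e (Function.update (fun j => v (e j)) i u) =
      (1 : Matrix (Fin d) (Fin d) k).updateCol i fun i' => (a u (e i') : k) := by
    rw [← h.weightMatrix_frame e]
    ext i' j
    rcases eq_or_ne j i with rfl | hj
    · simp [weightMatrix]
    · simp [weightMatrix, hj]
  rw [h1, ← Matrix.cramer_apply, Matrix.cramer_one]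
  rfl

/-- Multiplication by an edge invariant affine function has a trace that can be computed from the
values at any affinely independent set of weights. -/
theorem IsAffineFrame.sum_affFun_eq [Nonempty ι] [Infinite k] (h : IsAffineFrame a v) {d : ℕ}
    (e : Fin d ≃ I) (J : Fin d → ι)
    (hJ : (weightMatrix k a e J).det ≠ 0) {x : I → k} (hx : EdgeInvariant a v (affFun a x)) :
    ∑ j, affFun a x (J j) = ∑ i, x i := by
  set B := weightMatrix k a e J
  have hB : IsUnit B.det := isUnit_iff_ne_zero.2 hJ
  -- Multiplication by the function sends the `i`-th barycentric coordinate to `x i` times itself,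
  -- so `B` conjugates the two diagonal matrices and their traces agree.
  have h1 : B * Matrix.diagonal (fun j => affFun a x (J j)) =
      Matrix.diagonal (fun i => x (e i)) * B := by
    ext i j
    have h2 := IsAffineFrame.mul_affFun _ hx (Pi.single (e i) 1) (J j)
    have h3 : ∀ (c : k), affFun a (Pi.single (e i) c) (J j) = a (J j) (e i) * c := fun c => by
      simp [affFun_apply, Pi.single_apply]
    have h4 : (fun i' => affFun a x (v i') * (Pi.single (e i) 1 : I → k) i') =
        Pi.single (e i) (x (e i)) := by
      ext i'
      rw [h.affFun_frame]
      rcases eq_or_ne i' (e i) with rfl | hi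
      · simp
      · simp [hi]
    rw [h4, h3, h3] at h2
    rw [Matrix.mul_diagonal, Matrix.diagonal_mul]
    simp only [B, weightMatrix, Matrix.of_apply]
    linear_combination h2
  have h2 : Matrix.trace (Matrix.diagonal (fun j => affFun a x (J j))) =
      Matrix.trace (Matrix.diagonal (fun i => x (e i))) := by
    calc _ = Matrix.trace (B⁻¹ * (B * Matrix.diagonal (fun j => affFun a x (J j)))) := by
          rw [Matrix.nonsing_inv_mul_cancel_left _ _ hB]
      _ = _ := by
          rw [h1, Matrix.trace_mul_comm, Matrix.mul_nonsing_inv_cancel_right _ _ hB]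
  rw [Matrix.trace_diagonal, Matrix.trace_diagonal] at h2
  rw [h2]
  exact e.sum_comp x

variable (k a) in
/-- The affine functions, in terms of their values at the frame, that are edge invariant. -/
def edgeInvariantSubmodule : Submodule k (I → k) where
  carrier := {x | ∀ u i, (a u i : k) ≠ 0 → affFun a x u = x i}
  add_mem' := fun hx hy u i hui => by
    rw [map_add, Pi.add_apply, hx u i hui, hy u i hui, Pi.add_apply]
  zero_mem' := fun u i _ => by simp
  smul_mem' := fun c x hx u i hui => by
    rw [map_smul, Pi.smul_apply, hx u i hui, Pi.smul_apply]

theorem IsAffineFrame.mem_edgeInvariantSubmodule [Nonempty ι] [Infinite k]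
    (h : IsAffineFrame a v) (x : I → k) :
    x ∈ edgeInvariantSubmodule k a ↔ EdgeInvariant a v (affFun a x) := by
  refine forall_congr' fun u => forall_congr' fun i => ?_
  rw [h.affFun_frame]

/-- The left side says that the derivative of the Plücker vector is proportional to it, i.e. that
the sum of the function over every affinely independent `J` is the same. Exchanging one frame
element turns this into edge invariance; the trace argument gives the converse. -/
theorem IsAffineFrame.exists_forall_mul_sum_iff [Nonempty ι] [Infinite k]
    (h : IsAffineFrame a v) {d : ℕ} (e : Fin d ≃ I) {y : ι → k} (hy : ∀ u, y u ≠ 0) (x : I → k) :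
    (∃ c : k, ∀ J : Fin d → ι, eval y (gaussForm k a e J) * ∑ j, affFun a x (J j) =
      c * eval y (gaussForm k a e J)) ↔ x ∈ edgeInvariantSubmodule k a := by
  rw [h.mem_edgeInvariantSubmodule]
  have hprod : ∀ J : Fin d → ι, ∏ j, y (J j) ≠ 0 := fun J =>
    Finset.prod_ne_zero_iff.2 fun j _ => hy _
  constructor
  · rintro ⟨c, hc⟩
    have hc' : ∀ J, (weightMatrix k a e J).det ≠ 0 → ∑ j, affFun a x (J j) = c := by
      intro J hJ
      have h1 := hc J
      rw [mul_comm c, eval_gaussForm] at h1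
      exact mul_left_cancel₀ (mul_ne_zero hJ (hprod J)) h1
    intro u i hui
    have h1 := hc' (fun j => v (e j)) (by rw [h.weightMatrix_frame, Matrix.det_one]; exact one_ne_zero)
    have h2 := hc' (Function.update (fun j => v (e j)) (e.symm i) u) (by
      rwa [h.det_weightMatrix_update, e.apply_symm_apply])
    rw [← h1, ← Finset.add_sum_erase _ _ (Finset.mem_univ (e.symm i)),
      ← Finset.add_sum_erase Finset.univ (fun j => affFun a x (v (e j)))
        (Finset.mem_univ (e.symm i)), Function.update_self, e.apply_symm_apply] at h2
    refine add_right_cancel (h2.trans ?_)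
    congr 1
    refine Finset.sum_congr rfl fun j hj => ?_
    rw [Function.update_of_ne (Finset.ne_of_mem_erase hj)]
  · intro hx
    refine ⟨∑ i, x i, fun J => ?_⟩
    by_cases hJ : (weightMatrix k a e J).det = 0
    · rw [eval_gaussForm, hJ]
      simp
    · rw [h.sum_affFun_eq e J hJ hx, mul_comm]

variable [Nonempty ι] [Infinite k]

theorem IsAffineFrame.isRepresentedNear (h : IsAffineFrame a v)
    (e : Fin (dim (toricClosure k a) + 1) ≃ I) (x : smoothLocus (toricClosure k a))
    (hx0 : ∀ u, x.1.rep u ≠ 0) :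
    IsRepresentedNear (toricClosure k a) (fun y => plucker (gaussMap (toricClosure k a) y)) x
      (dim (toricClosure k a) + 1) (gaussForm k a e) := by
  refine ⟨isHomogeneous_gaussForm e, nonzeroLocus k ι, isOpen_nonzeroLocus, hx0, ?_⟩
  intro y hy0
  let b : Fin (dim (toricClosure k a) + 1) → ι → k := fun i =>
    tangentParam a y.1.rep (Pi.single (e i) 1)
  have hb : LinearIndependent k b := by
    have h1 : LinearIndependent k fun i => (Pi.single (e i) 1 : I → k) := by
      have h2 := (Pi.basisFun k I).linearIndependent.comp e e.injective
      convert h2 using 2 with i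
      simp
    exact h1.map' _ (LinearMap.ker_eq_bot.2 (h.tangentParam_injective hy0))
  have hbL : ∀ i, b i ∈ (gaussMap (toricClosure k a) y).1 := by
    intro i
    change b i ∈ embTangent _ _
    rw [h.embTangent_eq y.2.1 hy0]
    exact ⟨_, rfl⟩
  have hG : (fun J => eval y.1.rep (gaussForm k a e J)) = pluckerVector b := by
    ext J
    -- The factors `y (J j)` scale the columns of the minor, so they come out of the determinant.
    rw [eval_gaussForm, pluckerVector, mul_comm, ← Matrix.det_mul_row]
    congr 1
    ext i j
    simp [b, tangentParam_apply, affFun_apply, weightMatrix, Pi.single_apply]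
  refine ⟨hG ▸ pluckerVector_ne_zero b hb, ?_⟩
  simp only [plucker_eq_mk _ b hb hbL, hG]

/-- The rank of the Gauss map is the codimension of the space of edge invariant affine functions. -/
theorem IsAffineFrame.gaussRankEq (h : IsAffineFrame a v) {r : ℕ}
    (hr : Module.finrank k (edgeInvariantSubmodule k a) + r = Fintype.card I) :
    GaussRankEq (toricClosure k a) r := by
  refine forGeneralPoint_of_torus h fun y hy0 => ?_
  let e : Fin (dim (toricClosure k a) + 1) ≃ I :=
    (Fintype.equivFinOfCardEq h.dim_add_one.symm).symm
  refine ⟨_, gaussForm k a e, h.isRepresentedNear e y hy0, ?_⟩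
  have hT := h.embTangent_eq y.2.1 hy0
  have hker : (LinearMap.ker (differential (toricClosure k a) y.1 (gaussForm k a e))).map
      (embTangent (toricClosure k a) y.1).subtype =
      (edgeInvariantSubmodule k a).map (tangentParam a y.1.rep) := by
    have key : ∀ x (hx : tangentParam a y.1.rep x ∈ embTangent (toricClosure k a) y.1),
        differential (toricClosure k a) y.1 (gaussForm k a e) ⟨_, hx⟩ = 0 ↔
          x ∈ edgeInvariantSubmodule k a := by
      intro x hx
      rw [← h.exists_forall_mul_sum_iff e hy0]
      simp only [differential, LinearMap.comp_apply, Submodule.mkQ_apply,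
        Submodule.Quotient.mk_eq_zero, Submodule.mem_span_singleton, Submodule.subtype_apply]
      refine exists_congr fun c => ?_
      rw [funext_iff]
      refine forall_congr' fun J => ?_
      rw [← polyDifferential_gaussForm, eq_comm]
      rfl
    ext w
    simp only [Submodule.mem_map, LinearMap.mem_ker]
    constructor
    · rintro ⟨⟨w, hw⟩, hw0, rfl⟩
      obtain ⟨x, rfl⟩ : w ∈ LinearMap.range (tangentParam a y.1.rep) := hT ▸ hw
      exact ⟨x, (key x hw).1 hw0, rfl⟩
    · rintro ⟨x, hx, rfl⟩
      have hw : tangentParam a y.1.rep x ∈ embTangent (toricClosure k a) y.1 := by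
        rw [hT]
        exact ⟨x, rfl⟩
      exact ⟨⟨_, hw⟩, (key x hw).2 hx, rfl⟩
  have h1 := congrArg (fun S : Submodule k (ι → k) => Module.finrank k S) hker
  simp only [Submodule.finrank_map_subtype_eq] at h1
  rw [← (Submodule.equivMapOfInjective _ (h.tangentParam_injective hy0) _).finrank_eq] at h1
  have h2 := LinearMap.finrank_range_add_finrank_ker
    (differential (toricClosure k a) y.1 (gaussForm k a e))
  have h3 : Module.finrank k (embTangent (toricClosure k a) y.1) = Fintype.card I := by
    rw [y.2.2, h.dim_add_one]
  omega

end Rank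

end ToricGauss

namespace ToricGauss

open MvPolynomial

/-! ### Passage from barycentric coordinates to subsets of `ℤ^n`. -/

section Reindex

variable {k : Type*} [Field k] {ι κ I : Type*} [Fintype ι] [Fintype κ] [Fintype I]
  [DecidableEq I] {a : ι → I → ℤ} {v : I → ι}

theorem IsAffineFrame.comp_equiv (h : IsAffineFrame a v) (ε : κ ≃ ι) :
    IsAffineFrame (fun u => a (ε u)) fun i => ε.symm (v i) where
  sum_eq_one u := h.sum_eq_one (ε u)
  frame i := by rw [ε.apply_symm_apply, h.frame]

theorem edgeLattice_comp_equiv (ε : κ ≃ ι) :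
    edgeLattice k (fun u => a (ε u)) = edgeLattice k a := by
  rw [edgeLattice, edgeLattice]
  congr 1
  ext m
  exact ε.surjective.exists (p := fun u => ∃ i, (a u i : k) ≠ 0 ∧ m = a u - Pi.single i 1) |>.symm

theorem edgeInvariantSubmodule_comp_equiv (ε : κ ≃ ι) :
    edgeInvariantSubmodule k (fun u => a (ε u)) = edgeInvariantSubmodule k a := by
  ext x
  exact (ε.surjective.forall
    (p := fun u => ∀ i, (a u i : k) ≠ 0 → affFun a x u = x i)).symm

theorem IsFiberFrame.comp_equiv {M : Type*} [AddCommGroup M] {π : (I → ℤ) →+ M}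
    {δ : (I → ℤ) →+ ℤ} {c p : ℕ} (h : IsFiberFrame k a π δ c p) (ε : κ ≃ ι) :
    IsFiberFrame k (fun u => a (ε u)) π δ c p where
  map_edge u := h.map_edge (ε u)
  dvd_edge u := h.dvd_edge (ε u)
  nsmul_mem m := by
    rw [edgeLattice_comp_equiv]
    exact h.nsmul_mem m
  exists_eq_one := h.exists_eq_one

end Reindex

section Chart

variable {n : ℕ} {I : Type*} [Fintype I] [DecidableEq I] (e : I ≃ Fin (n + 1))

/-- Forgetting the barycentric coordinate with index `e.symm 0`. -/
def affineChart : (I → ℤ) →+ (Fin n → ℤ) where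
  toFun m j := m (e.symm j.succ)
  map_zero' := rfl
  map_add' _ _ := rfl

/-- The vectors with sum zero that have the given coordinates. -/
def affineChartSection : (Fin n → ℤ) →+ (I → ℤ) where
  toFun x i := (Fin.cons (-∑ j, x j) x : Fin (n + 1) → ℤ) (e i)
  map_zero' := by
    ext i
    refine Fin.cases ?_ (fun j => ?_) (e i) <;> simp
  map_add' x y := by
    ext i
    simp only [Pi.add_apply]
    refine Fin.cases ?_ (fun j => ?_) (e i) <;> simp [Finset.sum_add_distrib, add_comm]

theorem affineChartSection_affineChart (m : I → ℤ) :
    affineChartSection e (affineChart e m) + (∑ i, m i) • Pi.single (e.symm 0) 1 = m := by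
  ext i
  obtain ⟨j, rfl⟩ := e.symm.surjective i
  have h1 : ∑ i, m i = m (e.symm 0) + ∑ j : Fin n, m (e.symm j.succ) := by
    rw [← e.symm.sum_comp, Fin.sum_univ_succ]
  rw [h1]
  refine Fin.cases ?_ (fun j => ?_) j
  · simp [affineChartSection, affineChart]
  · have : e.symm j.succ ≠ e.symm 0 := fun h => (Fin.succ_ne_zero j) (e.symm.injective h)
    simp [affineChartSection, affineChart, this]

theorem affineSpan_eq_top_of_mem {S : Set (Fin n → ℤ)} (h0 : 0 ∈ S)
    (h1 : ∀ j, Pi.single j 1 ∈ S) : affineSpan ℤ S = ⊤ := by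
  rw [eq_top_iff]
  intro x _
  have hmem : ∀ y ∈ S, y ∈ (affineSpan ℤ S).direction := fun y hy => by
    have := AffineSubspace.vsub_mem_direction (subset_affineSpan ℤ S hy)
      (subset_affineSpan ℤ S h0)
    simpa using this
  have hx : x ∈ (affineSpan ℤ S).direction := by
    rw [pi_eq_sum_univ' x]
    exact Submodule.sum_mem _ fun j _ => Submodule.smul_mem _ _ (hmem _ (h1 j))
  have := AffineSubspace.vadd_mem_of_mem_direction hx (subset_affineSpan ℤ S h0)
  simpa using this

/-- The toric variety of a finite set `A`, in terms of barycentric coordinates of its elements. -/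
theorem toricVariety_eq_toricClosure {k : Type*} [Field k] [Infinite k] {A : Finset (Fin n → ℤ)}
    [Nonempty A] (a : A → I → ℤ) (ha : ∀ u, affineChart e (a u) = u)
    (hsum : ∀ u, ∑ i, a u i = 1) : toricVariety k A = toricClosure k a := by
  rw [toricVariety, toricClosure]
  congr 1
  ext y
  constructor
  · rintro ⟨t, ht, rfl⟩
    refine ⟨t.comp (AddMonoidHom.toMultiplicative (affineChart e)), ?_⟩
    refine congrArg (torusPt (k := k)) (funext fun u : A => ?_) |>.trans
      (b := torusPt fun u : A => t (Multiplicative.ofAdd (u : Fin n → ℤ))) rfl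
    simp [evalChar, ha]
  · rintro ⟨s, rfl⟩
    let t : Multiplicative (Fin n → ℤ) →* kˣ :=
      s.comp (AddMonoidHom.toMultiplicative (affineChartSection e))
    refine ⟨t, coe_units_ne_zero fun u : A => t (Multiplicative.ofAdd (u : Fin n → ℤ)), ?_⟩
    -- The character value at the omitted frame element multiplies all coordinates, as each `a u`
    -- has sum one, and disappears in projective space.
    refine Eq.trans ?_ (torusPt_smul (s (Multiplicative.ofAdd (Pi.single (e.symm 0) 1))) _)
    refine congrArg torusPt (funext fun u => ?_)
    have h1 := affineChartSection_affineChart e (a u)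
    rw [ha, hsum, one_smul] at h1
    have h2 : evalChar (a u) s = s (Multiplicative.ofAdd (a u)) := rfl
    rw [Pi.one_apply, one_mul, h2, ← h1, ofAdd_add, map_mul, mul_comm]
    rfl

end Chart

/-- A combinatorial criterion for the existence of a toric variety with prescribed fibers and rank
of the Gauss map. -/
theorem exists_toricVariety {k : Type*} [Field k] [IsAlgClosed k] {p : ℕ} [CharP k p]
    [Fact p.Prime] {M : Type*} [AddCommGroup M] [Module.Free ℤ M] [Module.Finite ℤ M]
    (A' : Finset M) {r c n N : ℕ} (hc : 0 < c) (hcp : c.Coprime p)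
    {ι I : Type*} [Fintype ι] [Fintype I] [DecidableEq I] {a : ι → I → ℤ} {v : I → ι}
    (ha : Function.Injective a) (h : IsAffineFrame a v) {π : (I → ℤ) →+ M} {δ : (I → ℤ) →+ ℤ}
    (hF : IsFiberFrame k a π δ c p) (hA' : ∀ u, π (a u) ∈ A') (hsurj : ∀ m ∈ A', ∃ u, π (a u) = m)
    (hr : Module.finrank k (edgeInvariantSubmodule k a) + r = Fintype.card I)
    (hn : Fintype.card I = n + 1) (hN : Fintype.card ι = N + 1) :
    ∃ A : Finset (Fin n → ℤ),
      affineSpan ℤ (A : Set (Fin n → ℤ)) = ⊤ ∧ A.card = N + 1 ∧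
      ForGeneralPoint (toricVariety k A) (fun x =>
        ∀ F ∈ irreducibleComponents (gaussFiber (toricVariety k A) x),
          ProjEquiv (closure (Subtype.val '' F)) (toricVariety k A')) ∧
      GaussRankEq (toricVariety k A) r ∧
      ForGeneralPoint (toricVariety k A) (fun x =>
        (irreducibleComponents (gaussFiber (toricVariety k A) x)).ncard = c) := by
  classical
  let e : I ≃ Fin (n + 1) := Fintype.equivFinOfCardEq hn
  have hinj : Function.Injective fun u => affineChart e (a u) := by
    intro u u' huu'
    refine ha ?_
    rw [← affineChartSection_affineChart e (a u), ← affineChartSection_affineChart e (a u'),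
      h.sum_eq_one, h.sum_eq_one]
    simp only [huu']
  let A : Finset (Fin n → ℤ) := Finset.univ.image fun u => affineChart e (a u)
  have hcard : A.card = N + 1 := by
    rw [Finset.card_image_of_injective _ hinj, Finset.card_univ, hN]
  have hne : Nonempty A := by
    refine (Finset.card_pos.1 ?_).to_subtype
    omega
  have hmem : ∀ u, affineChart e (a u) ∈ A := fun u =>
    Finset.mem_image_of_mem _ (Finset.mem_univ u)
  let φ : ι ≃ A := Equiv.ofBijective (fun u => ⟨affineChart e (a u), hmem u⟩)
    ⟨fun u u' huu' => hinj (congrArg Subtype.val huu'), by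
      rintro ⟨y, hy⟩
      obtain ⟨u, -, rfl⟩ := Finset.mem_image.1 hy
      exact ⟨u, rfl⟩⟩
  have hφ : ∀ u : A, affineChart e (a (φ.symm u)) = u := fun u =>
    congrArg Subtype.val (φ.apply_symm_apply u)
  have h' := h.comp_equiv φ.symm
  have hF' := hF.comp_equiv φ.symm
  have hX : toricVariety k A = toricClosure k fun u => a (φ.symm u) :=
    toricVariety_eq_toricClosure e _ hφ h'.sum_eq_one
  have hfib : ∀ x : smoothLocus (toricClosure k fun u => a (φ.symm u)),
      (∀ u, x.1.rep u ≠ 0) → _ := fun x hx0 =>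
    hF'.fiber_components hc hcp h' A' (fun u => hA' _)
      (fun m hm => (hsurj m hm).imp' φ fun u hu => by rwa [φ.symm_apply_apply]) x hx0
  refine ⟨A, ?_, hcard, ?_⟩
  · refine affineSpan_eq_top_of_mem ?_ fun j => ?_
    · have := hmem (v (e.symm 0))
      rw [h.frame] at this
      have h0 : affineChart e (Pi.single (e.symm 0) 1) = 0 := by
        ext j
        have hj : e.symm j.succ ≠ e.symm 0 := fun h => (Fin.succ_ne_zero j) (e.symm.injective h)
        simp [affineChart, hj]
      rwa [h0] at this
    · have := hmem (v (e.symm j.succ))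
      rw [h.frame] at this
      have h0 : affineChart e (Pi.single (e.symm j.succ) 1) = Pi.single j 1 := by
        ext j'
        simp [affineChart, Pi.single_apply]
      rwa [h0] at this
  · rw [hX]
    refine ⟨forGeneralPoint_of_torus h' fun x hx0 => (hfib x hx0).1, h'.gaussRankEq ?_,
      forGeneralPoint_of_torus h' fun x hx0 => (hfib x hx0).2⟩
    rw [edgeInvariantSubmodule_comp_equiv, hr]

end ToricGauss

namespace ToricGauss

open MvPolynomial

/-! ### Generators, kernels and homogenization of lattices. -/

section Lattices

/-- A nonzero lattice is generated by any sufficiently large number of distinct nonzero elements,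
suitably chosen. -/
theorem exists_injective_generators {V : Type*} [AddCommGroup V] [Module.Free ℤ V]
    [Module.Finite ℤ V] (Y : Submodule ℤ V) (hY : Y ≠ ⊥) {t : ℕ}
    (ht : Module.finrank ℤ Y ≤ t) :
    ∃ μ : Fin t → V, Function.Injective μ ∧ (∀ j, μ j ≠ 0) ∧ (∀ j, μ j ∈ Y) ∧
      Y ≤ Submodule.span ℤ (Set.range μ) := by
  classical
  let b := Module.finBasis ℤ Y
  have hnt : Nontrivial Y := Submodule.nontrivial_iff_ne_bot.2 hY
  have hinf : Infinite Y := by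
    obtain ⟨y, hy⟩ := exists_ne (0 : Y)
    exact Infinite.of_injective (fun z : ℤ => z • y) (smul_left_injective ℤ hy)
  have hinf' : Infinite {y : Y // y ≠ 0} := (Set.finite_singleton (0 : Y)).infinite_compl.to_subtype
  obtain ⟨T, hbT, hT⟩ := Infinite.exists_superset_card_eq
    (Finset.univ.image fun i => (⟨b i, b.ne_zero i⟩ : {y : Y // y ≠ 0})) t
    ((Finset.card_image_le).trans (by simpa using ht))
  let ε : Fin t ≃ T := (T.equivFinOfCardEq hT).symm
  refine ⟨fun j => ((ε j : {y : Y // y ≠ 0}) : Y), ?_, ?_, ?_, ?_⟩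
  · intro i j hij
    exact ε.injective (Subtype.ext (Subtype.ext (Subtype.ext hij)))
  · intro j h0
    exact (ε j : {y : Y // y ≠ 0}).2 (Subtype.ext h0)
  · intro j
    exact ((ε j : {y : Y // y ≠ 0}) : Y).2
  · intro y hy
    have h1 : (y : V) = ∑ i, b.repr ⟨y, hy⟩ i • ((b i : Y) : V) := by
      have := congrArg Subtype.val (b.sum_repr ⟨y, hy⟩)
      rw [Submodule.coe_sum] at this
      exact this.symm
    rw [h1]
    refine Submodule.sum_mem _ fun i _ => Submodule.smul_mem _ _ (Submodule.subset_span ?_)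
    have h2 : (⟨b i, b.ne_zero i⟩ : {y : Y // y ≠ 0}) ∈ T :=
      hbT (Finset.mem_image_of_mem _ (Finset.mem_univ i))
    exact ⟨ε.symm ⟨_, h2⟩, by simp⟩

/-- The kernel of a surjection between lattices is a direct summand. -/
theorem exists_coordinate_on_ker {V W : Type*} [AddCommGroup V] [Module.Free ℤ V]
    [Module.Finite ℤ V] [AddCommGroup W] [Module.Free ℤ W] [Module.Finite ℤ W]
    (f : V →ₗ[ℤ] W) (hf : Function.Surjective f) :
    Module.finrank ℤ (LinearMap.ker f) + Module.finrank ℤ W = Module.finrank ℤ V ∧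
      (Module.finrank ℤ W < Module.finrank ℤ V →
        ∃ (δ : V →ₗ[ℤ] ℤ) (x : V), f x = 0 ∧ δ x = 1) := by
  have h1 : Module.finrank ℤ (LinearMap.ker f) + Module.finrank ℤ W = Module.finrank ℤ V := by
    rw [← (f.quotKerEquivOfSurjective hf).finrank_eq, add_comm]
    exact Submodule.finrank_quotient_add_finrank _
  refine ⟨h1, fun hlt => ?_⟩
  -- A section `s` splits the kernel off through `id - s ∘ f`; the functional is a coordinate of
  -- this kernel part, hence takes the value `1` on the kernel.
  obtain ⟨s, hs⟩ := Module.projective_lifting_property f LinearMap.id hf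
  have hs' : ∀ w, f (s w) = w := fun w => LinearMap.congr_fun hs w
  let b := Module.finBasis ℤ (LinearMap.ker f)
  let i : Fin (Module.finrank ℤ (LinearMap.ker f)) := ⟨0, by omega⟩
  let ρ : V →ₗ[ℤ] LinearMap.ker f := LinearMap.codRestrict _ (LinearMap.id - s ∘ₗ f) fun x => by
    simp [hs']
  refine ⟨b.coord i ∘ₗ ρ, b i, (b i).2, ?_⟩
  have : ρ (b i) = b i := by
    ext
    have := (b i).2
    rw [LinearMap.mem_ker] at this
    simp [ρ, this]
  simp [this]

/-- The homomorphism with the values `(1, σ j)` at the standard basis. -/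
def homogenization {M J : Type*} [AddCommGroup M] [Fintype J] (σ : J → M) :
    (J → ℤ) →ₗ[ℤ] ℤ × M where
  toFun x := (∑ j, x j, ∑ j, x j • σ j)
  map_add' x y := by simp [Finset.sum_add_distrib, add_smul]
  map_smul' c x := by simp [Finset.mul_sum, Finset.smul_sum, mul_smul]

theorem homogenization_surjective {M J : Type*} [AddCommGroup M] [Fintype J] {σ : J → M}
    (hσ : affineSpan ℤ (Set.range σ) = ⊤) : Function.Surjective (homogenization σ) := by
  classical
  have h1 : ∀ m : M, ∃ x, homogenization σ x = (1, m) := by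
    intro m
    have hm : m ∈ affineSpan ℤ (Set.range σ) := hσ ▸ AffineSubspace.mem_top ℤ M m
    refine affineSpan_induction (p := fun m => ∃ x, homogenization σ x = (1, m)) hm ?_ ?_
    · rintro _ ⟨j, rfl⟩
      exact ⟨Pi.single j 1, by simp [homogenization, Pi.single_apply]⟩
    · rintro z u v w ⟨x, hx⟩ ⟨y, hy⟩ ⟨x', hx'⟩
      refine ⟨z • (x - y) + x', ?_⟩
      rw [map_add, map_smul, map_sub, hx, hy, hx']
      simp
  rintro ⟨z, m⟩
  obtain ⟨x, hx⟩ := h1 m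
  obtain ⟨y, hy⟩ := h1 0
  -- Preimages of `(1, m)` and `(1, 0)` differ by one of `(0, m)`, and the latter also adjusts the
  -- first coordinate.
  refine ⟨x - y + z • y, ?_⟩
  rw [map_add, map_smul, map_sub, hx, hy]
  simp

end Lattices

/-! ### The weights with prescribed edge lattice. -/

section Construction

variable {r s t : ℕ} {J : Type*} [Fintype J] [DecidableEq J]

/-- Collapsing the first `r` elements of the frame to the element `o`. -/
def collapse (o : J) : (Fin r ⊕ J → ℤ) →ₗ[ℤ] (J → ℤ) where
  toFun m := (fun j => m (Sum.inr j)) + (∑ i, m (Sum.inl i)) • Pi.single o 1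
  map_add' m m' := by
    simp only [Pi.add_apply, Finset.sum_add_distrib, add_smul]
    ext j
    simp only [Pi.add_apply]
    ring
  map_smul' c m := by
    ext j
    simp only [Pi.smul_apply, Pi.add_apply, smul_eq_mul, ← Finset.mul_sum, RingHom.id_apply]
    ring

/-- The inclusion of `J → ℤ`. -/
def inclusion : (J → ℤ) →ₗ[ℤ] (Fin r ⊕ J → ℤ) where
  toFun x := Sum.elim 0 x
  map_add' x y := by ext (i | j) <;> simp
  map_smul' c x := by ext (i | j) <;> simp

theorem collapse_apply (o : J) (m : Fin r ⊕ J → ℤ) :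
    collapse o m = (fun j => m (Sum.inr j)) + (∑ i, m (Sum.inl i)) • Pi.single o 1 := rfl

theorem inclusion_inl (x : J → ℤ) (i : Fin r) : inclusion x (Sum.inl i) = 0 := rfl

theorem inclusion_inr (x : J → ℤ) (j : J) : inclusion (r := r) x (Sum.inr j) = x j := rfl

theorem collapse_inclusion (o : J) (x : J → ℤ) : collapse o (inclusion (r := r) x) = x := by
  ext j
  simp [collapse_apply, inclusion_inl, inclusion_inr]

theorem collapse_single_inl (o : J) (i : Fin r) :
    collapse o (Pi.single (Sum.inl i) 1) = Pi.single o 1 := by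
  ext j
  simp [collapse_apply, Pi.single_apply]

theorem collapse_single_inr (o j : J) :
    collapse o (Pi.single (Sum.inr j : Fin r ⊕ J) 1) = Pi.single j 1 := by
  ext j'
  simp [collapse_apply, Pi.single_apply]

theorem sum_collapse (o : J) (m : Fin r ⊕ J → ℤ) : ∑ j, collapse o m j = ∑ i, m i := by
  rw [Fintype.sum_sum_type]
  simp [collapse_apply, Finset.sum_add_distrib, Pi.single_apply, add_comm]

/-- A weight in the affine span of the first `r` elements of the frame and `o`. -/
def extraWeight (o : J) (x : Fin r → ℤ) : Fin r ⊕ J → ℤ :=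
  Sum.elim x (Pi.single o (1 - ∑ i, x i))

theorem collapse_extraWeight (o : J) (x : Fin r → ℤ) :
    collapse o (extraWeight o x) = Pi.single o 1 := by
  ext j
  rcases eq_or_ne j o with rfl | hj
  · simp [collapse_apply, extraWeight]
  · simp [collapse_apply, extraWeight, hj]

/-- The conditions on the extra weights `x`: they are distinct, they are not in the frame, and
modulo the characteristic of `k` they connect the first `r` elements of the frame with `o`. -/
structure IsConnecting (k : Type*) [Field k] (x : Fin s → Fin r → ℤ) : Prop where
  injective : Function.Injective x
  exists_ne_zero : ∀ ε, ∃ i, x ε i ≠ 0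
  sum_ne_one : ∀ ε, 1 - ∑ i, x ε i ≠ 0
  -- The form with arbitrary predicates serves twice: for membership of differences in the edge
  -- lattice and for equality of values of edge invariant functions.
  connected : ∀ (P : Fin s → Prop) (P' : Fin r → Prop),
    (∀ ε i, (x ε i : k) ≠ 0 → (P ε ↔ P' i)) → (∀ ε, ((1 - ∑ i, x ε i : ℤ) : k) ≠ 0 → P ε) →
    ∀ i, P' i

/-- The weights of the toric variety: the frame, the extra weights, and the translations of the
element `l` of the frame by multiples of `p`. -/
def toricWeights (p : ℕ) (o l : J) (x : Fin s → Fin r → ℤ) (μ : Fin t → J → ℤ) :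
    (Fin r ⊕ J) ⊕ Fin s ⊕ Fin t → Fin r ⊕ J → ℤ :=
  Sum.elim (fun i => Pi.single i 1)
    (Sum.elim (fun ε => extraWeight o (x ε))
      fun j => Pi.single (Sum.inr l) 1 + p • inclusion (μ j))

variable {p : ℕ} {o l : J} {x : Fin s → Fin r → ℤ} {μ : Fin t → J → ℤ}

theorem isAffineFrame_toricWeights (hμ : ∀ j, ∑ i, μ j i = 0) :
    IsAffineFrame (toricWeights p o l x μ) Sum.inl where
  sum_eq_one u := by
    rcases u with i | ε | j
    · simp [toricWeights]
    · simp only [toricWeights, Sum.elim_inr, Sum.elim_inl]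
      rw [← sum_collapse o, collapse_extraWeight]
      simp
    · simp only [toricWeights, Sum.elim_inr]
      rw [← sum_collapse o, map_add, map_nsmul, collapse_inclusion, collapse_single_inr]
      simp [Finset.sum_add_distrib, ← Finset.mul_sum, hμ]
  frame _ := rfl

theorem toricWeights_injective {k : Type*} [Field k] (hx : IsConnecting k x) (hlo : l ≠ o)
    (hp : 1 < p) (hμ : Function.Injective μ) (hμ0 : ∀ j, μ j ≠ 0) :
    Function.Injective (toricWeights p o l x μ) := by
  have hp0 : p ≠ 0 := by omega
  have hfat : ∀ j, (Pi.single (Sum.inr l) 1 + p • inclusion (μ j) : Fin r ⊕ J → ℤ) (Sum.inr l) =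
      1 + p * μ j l := fun j => by simp [inclusion_inr]
  -- The coordinate at `l` of a translated weight is `1` modulo `p`, hence nonzero, whereas the
  -- extra weights and the other frame elements vanish there.
  have hfat0 : ∀ j, 1 + p * μ j l ≠ 0 := by
    intro j h0
    have h1 : (p : ℤ) ∣ 1 := ⟨-μ j l, by linarith⟩
    have h2 := Int.le_of_dvd one_pos h1
    omega
  have h12 : ∀ i ε, (Pi.single i 1 : Fin r ⊕ J → ℤ) ≠ extraWeight o (x ε) := by
    intro i ε h0
    obtain ⟨i', hi'⟩ := hx.exists_ne_zero ε
    have h1 := congrFun h0 (Sum.inl i')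
    have h2 := congrFun h0 (Sum.inr o)
    simp only [extraWeight, Sum.elim_inl, Sum.elim_inr, Pi.single_eq_same] at h1 h2
    rcases i with i | i
    · rw [Pi.single_eq_of_ne (by simp)] at h2
      exact hx.sum_ne_one ε h2.symm
    · rw [Pi.single_eq_of_ne (by simp)] at h1
      exact hi' h1.symm
  have h13 : ∀ i j, (Pi.single i 1 : Fin r ⊕ J → ℤ) ≠
      Pi.single (Sum.inr l) 1 + p • inclusion (μ j) := by
    intro i j h0
    have h1 := congrFun h0 (Sum.inr l)
    rw [hfat] at h1
    by_cases hi : i = Sum.inr l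
    · subst hi
      refine hμ0 j (funext fun i' => ?_)
      have h2 := congrFun (left_eq_add.1 h0) (Sum.inr i')
      simpa [inclusion_inr, hp0] using h2
    · rw [Pi.single_eq_of_ne' hi] at h1
      exact hfat0 j h1.symm
  have h23 : ∀ ε j, extraWeight o (x ε) ≠ Pi.single (Sum.inr l) 1 + p • inclusion (μ j) := by
    intro ε j h0
    have h1 := congrFun h0 (Sum.inr l)
    rw [hfat] at h1
    simp only [extraWeight, Sum.elim_inr, Pi.single_eq_of_ne hlo] at h1
    exact hfat0 j h1.symm
  rintro (i | ε | j) (i' | ε' | j') huu'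
  · simp only [toricWeights, Sum.elim_inl] at huu'
    by_contra hne
    have hne' : i ≠ i' := fun h => hne (by rw [h])
    have h1 := congrFun huu' i
    rw [Pi.single_eq_same, Pi.single_eq_of_ne hne'] at h1
    exact one_ne_zero h1
  · exact absurd huu' (h12 i ε')
  · exact absurd huu' (h13 i j')
  · exact absurd huu'.symm (h12 i' ε)
  · have h1 : x ε = x ε' := funext fun i => congrFun huu' (Sum.inl i)
    rw [hx.injective h1]
  · exact absurd huu' (h23 ε j')
  · exact absurd huu'.symm (h13 i' j)
  · exact absurd huu'.symm (h23 ε' j)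
  · have h1 : μ j = μ j' := by
      have h2 := add_left_cancel (a := (Pi.single (Sum.inr l) 1 : Fin r ⊕ J → ℤ)) huu'
      ext i
      have h3 := congrFun h2 (Sum.inr i)
      simpa [inclusion_inr, hp0] using h3
    rw [hμ h1]

variable {k : Type*} [Field k] [CharP k p]

theorem eq_of_toricWeights_inl_ne_zero {i i' : Fin r ⊕ J}
    (h : (toricWeights p o l x μ (Sum.inl i) i' : k) ≠ 0) : i' = i := by
  by_contra hne
  simp [toricWeights, hne] at h

theorem eq_of_toricWeights_fat_ne_zero {j : Fin t} {i : Fin r ⊕ J}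
    (h : (toricWeights p o l x μ (Sum.inr (Sum.inr j)) i : k) ≠ 0) : i = Sum.inr l := by
  by_contra hne
  simp [toricWeights, hne] at h

theorem toricWeights_fat_ne_zero (j : Fin t) :
    (toricWeights p o l x μ (Sum.inr (Sum.inr j)) (Sum.inr l) : k) ≠ 0 := by
  simp [toricWeights]

theorem eq_of_toricWeights_extra_ne_zero {ε : Fin s} {i : Fin r ⊕ J}
    (h : (toricWeights p o l x μ (Sum.inr (Sum.inl ε)) i : k) ≠ 0) :
    (∃ i', i = Sum.inl i') ∨ i = Sum.inr o := by
  rcases i with i | i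
  · exact Or.inl ⟨i, rfl⟩
  · right
    by_contra hne
    have hne' : i ≠ o := fun h => hne (by rw [h])
    simp [toricWeights, extraWeight, hne'] at h

theorem collapse_toricWeights_edge {u : (Fin r ⊕ J) ⊕ Fin s ⊕ Fin t} {i : Fin r ⊕ J}
    (h : (toricWeights p o l x μ u i : k) ≠ 0) :
    collapse o (toricWeights p o l x μ u) = collapse o (Pi.single i 1) ∨
      ∃ j, collapse o (toricWeights p o l x μ u) = collapse o (Pi.single i 1) + p • μ j := by
  rcases u with i' | ε | j
  · left
    rw [eq_of_toricWeights_inl_ne_zero h]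
    rfl
  · left
    have h1 : collapse o (toricWeights p o l x μ (Sum.inr (Sum.inl ε))) = Pi.single o 1 :=
      collapse_extraWeight o (x ε)
    rw [h1]
    rcases eq_of_toricWeights_extra_ne_zero h with ⟨i', rfl⟩ | rfl
    · rw [collapse_single_inl]
    · rw [collapse_single_inr]
  · right
    refine ⟨j, ?_⟩
    rw [eq_of_toricWeights_fat_ne_zero h]
    simp only [toricWeights, Sum.elim_inr]
    rw [map_add, map_nsmul, collapse_inclusion]

theorem single_sub_single_mem_edgeLattice (hx : IsConnecting k x) (i : Fin r) :
    Pi.single (Sum.inl i) 1 - Pi.single (Sum.inr o) 1 ∈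
      edgeLattice k (toricWeights p o l x μ) := by
  refine hx.connected (fun ε => extraWeight o (x ε) - Pi.single (Sum.inr o) 1 ∈
      edgeLattice k (toricWeights p o l x μ))
    (fun i => Pi.single (Sum.inl i) 1 - Pi.single (Sum.inr o) 1 ∈
      edgeLattice k (toricWeights p o l x μ)) (fun ε i hi => ?_) (fun ε hε => ?_) i
  · have h1 : extraWeight o (x ε) - Pi.single (Sum.inl i) 1 ∈
        edgeLattice k (toricWeights p o l x μ) :=
      AddSubgroup.subset_closure ⟨Sum.inr (Sum.inl ε), Sum.inl i, hi, rfl⟩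
    rw [← sub_add_sub_cancel _ (Pi.single (Sum.inl i) 1) (Pi.single (Sum.inr o) 1)]
    exact (AddSubgroup.add_mem_cancel_left _ h1)
  · refine AddSubgroup.subset_closure ⟨Sum.inr (Sum.inl ε), Sum.inr o, ?_, rfl⟩
    simpa [toricWeights, extraWeight] using hε

variable {M : Type*} [AddCommGroup M] {σ : J → M} {c : ℕ} {δ : (J → ℤ) →ₗ[ℤ] ℤ}

/-- The lattice of relations between the `σ j` on which `δ` is divisible by `c`. -/
def relationLattice (σ : J → M) (δ : (J → ℤ) →ₗ[ℤ] ℤ) (c : ℕ) : Submodule ℤ (J → ℤ) :=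
  LinearMap.ker (homogenization σ) ⊓ Submodule.comap δ (Ideal.span {(c : ℤ)})

theorem mem_relationLattice {m : J → ℤ} : m ∈ relationLattice σ δ c ↔
    (∑ j, m j = 0 ∧ ∑ j, m j • σ j = 0) ∧ (c : ℤ) ∣ δ m := by
  rw [relationLattice, Submodule.mem_inf, LinearMap.mem_ker, Submodule.mem_comap,
    Ideal.mem_span_singleton]
  refine and_congr ?_ Iff.rfl
  rw [homogenization]
  simp [Prod.ext_iff]

/-- After collapsing the first `r` frame elements to `o`, the only edges that survive are the `p
μ_j`, and the `μ_j` span the relations on which `c` divides `δ`. -/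
theorem isFiberFrame_toricWeights (hx : IsConnecting k x)
    (hμ : ∀ j, μ j ∈ relationLattice σ δ c)
    (hspan : relationLattice σ δ c ≤ Submodule.span ℤ (Set.range μ))
    (hδ : ∃ m, homogenization σ m = 0 ∧ δ m = 1) :
    IsFiberFrame k (toricWeights p o l x μ)
      ((LinearMap.snd ℤ ℤ M ∘ₗ homogenization σ ∘ₗ collapse o).toAddMonoidHom)
      ((δ ∘ₗ collapse o).toAddMonoidHom) c p where
  map_edge u i hui := by
    simp only [LinearMap.toAddMonoidHom_coe, LinearMap.comp_apply]
    rcases collapse_toricWeights_edge hui with h1 | ⟨j, h1⟩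
    · rw [h1]
    · have h2 := (mem_relationLattice.1 (hμ j)).1.2
      rw [h1, map_add, map_nsmul, map_add, map_nsmul]
      have h3 : (LinearMap.snd ℤ ℤ M) (homogenization σ (μ j)) = 0 := h2
      rw [h3, smul_zero, add_zero]
  dvd_edge u i hui := by
    simp only [LinearMap.toAddMonoidHom_coe, LinearMap.comp_apply]
    rcases collapse_toricWeights_edge hui with h1 | ⟨j, h1⟩
    · rw [h1, sub_self]
      exact dvd_zero _
    · rw [h1, map_add, map_nsmul, add_sub_cancel_left, nsmul_eq_mul]
      exact Dvd.dvd.mul_left (mem_relationLattice.1 (hμ j)).2 _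
  nsmul_mem m hm0 hmπ hmδ := by
    have h1 : collapse o m ∈ relationLattice σ δ c :=
      mem_relationLattice.2 ⟨⟨by rw [sum_collapse, hm0], hmπ⟩, hmδ⟩
    -- The kernel of `collapse` is spanned by the differences with `o`, which lie in the edge
    -- lattice by connectedness.
    have h2 : m = inclusion (collapse o m) +
        ∑ i, m (Sum.inl i) • (Pi.single (Sum.inl i) 1 - Pi.single (Sum.inr o) 1) := by
      ext (i | j)
      · simp [inclusion_inl, Finset.sum_apply, Pi.single_apply]
      · simp [inclusion_inr, collapse_apply, Finset.sum_apply, Finset.sum_mul, Pi.single_apply]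
    have h3 : ∀ y ∈ Submodule.span ℤ (Set.range μ),
        p • inclusion y ∈ edgeLattice k (toricWeights p o l x μ) := by
      intro y hy
      induction hy using Submodule.span_induction with
      | mem y hy =>
        obtain ⟨j, rfl⟩ := hy
        refine AddSubgroup.subset_closure
          ⟨Sum.inr (Sum.inr j), Sum.inr l, toricWeights_fat_ne_zero j, ?_⟩
        simp [toricWeights]
      | zero => simp
      | add y y' _ _ hy hy' =>
        rw [map_add, smul_add]
        exact add_mem hy hy'
      | smul z y _ hy =>
        rw [map_smul, smul_comm]
        exact zsmul_mem hy z
    rw [h2, smul_add]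
    refine add_mem (h3 _ (hspan h1)) (nsmul_mem (sum_mem fun i _ => zsmul_mem ?_ _) _)
    exact single_sub_single_mem_edgeLattice hx i
  exists_eq_one := by
    obtain ⟨m, hm, hmδ⟩ := hδ
    have h1 := congrArg Prod.fst hm
    have h2 := congrArg Prod.snd hm
    refine ⟨inclusion m, ?_, ?_, ?_⟩
    · rw [← sum_collapse o, collapse_inclusion]
      exact h1
    · simp only [LinearMap.toAddMonoidHom_coe, LinearMap.comp_apply, collapse_inclusion]
      exact h2
    · simp only [LinearMap.toAddMonoidHom_coe, LinearMap.comp_apply, collapse_inclusion, hmδ]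

/-- Connectedness forces the value at `o` on the first `r` frame elements, while the values on `J`
stay free because the translated weights coincide with `l` modulo `p`. -/
theorem finrank_edgeInvariantSubmodule_toricWeights [Infinite k] (hx : IsConnecting k x)
    (hμ : ∀ j, ∑ i, μ j i = 0) :
    Module.finrank k (edgeInvariantSubmodule k (toricWeights p o l x μ)) = Fintype.card J := by
  have : Nonempty ((Fin r ⊕ J) ⊕ Fin s ⊕ Fin t) := ⟨Sum.inl (Sum.inr o)⟩
  let f : (J → k) →ₗ[k] (Fin r ⊕ J → k) :=
    { toFun := fun y => Sum.elim (fun _ => y o) y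
      map_add' := fun y z => by ext (i | j) <;> simp
      map_smul' := fun z y => by ext (i | j) <;> simp }
  have hf : Function.Injective f := fun y z hyz => funext fun j => congrFun hyz (Sum.inr j)
  have hrange : edgeInvariantSubmodule k (toricWeights p o l x μ) = LinearMap.range f := by
    have hfr := isAffineFrame_toricWeights (p := p) (o := o) (l := l) (x := x) hμ
    ext y
    constructor
    · intro hy
      have hy' : ∀ u i, (toricWeights p o l x μ u i : k) ≠ 0 →
        affFun (toricWeights p o l x μ) y u = y i := hy
      have h1 := hx.connected
        (fun ε => affFun (toricWeights p o l x μ) y (Sum.inr (Sum.inl ε)) = y (Sum.inr o))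
        (fun i => y (Sum.inl i) = y (Sum.inr o))
        (fun ε i hi => by rw [hy' (Sum.inr (Sum.inl ε)) (Sum.inl i) hi])
        (fun ε hε => hy' (Sum.inr (Sum.inl ε)) (Sum.inr o) (by
          simpa [toricWeights, extraWeight] using hε))
      refine ⟨fun j => y (Sum.inr j), ?_⟩
      ext (i | j)
      · exact (h1 i).symm
      · rfl
    · rintro ⟨y, rfl⟩ u i hui
      rcases u with i' | ε | j
      · rw [eq_of_toricWeights_inl_ne_zero hui]
        simp [affFun_apply, toricWeights, Pi.single_apply]
      · have h1 : affFun (toricWeights p o l x μ) (f y) (Sum.inr (Sum.inl ε)) = y o := by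
          rw [affFun_apply, Fintype.sum_sum_type]
          simp only [toricWeights, extraWeight, f, Sum.elim_inr, Sum.elim_inl, LinearMap.coe_mk,
            AddHom.coe_mk]
          rw [← Finset.sum_mul, Finset.sum_eq_single o]
          · rw [Pi.single_eq_same]
            push_cast
            ring
          · intro j _ hj
            simp [hj]
          · simp
        rw [h1]
        rcases eq_of_toricWeights_extra_ne_zero hui with ⟨i', rfl⟩ | rfl <;> rfl
      · rw [eq_of_toricWeights_fat_ne_zero hui]
        simp [affFun_apply, toricWeights, Pi.single_apply]
  rw [hrange, LinearMap.finrank_range_of_inj hf, Module.finrank_fintype_fun_eq_card]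

end Construction

end ToricGauss

namespace ToricGauss

/-! ### Extra weights with suitable supports modulo the characteristic. -/

section Connecting

variable {k : Type*} [Field k] {r : ℕ}

/-- One weight suffices if all its `r + 1` barycentric coordinates are nonzero in `k`. In
characteristic two these would be `r + 1` odd integers of sum one, which requires `r` even.
Alternating signs leave the coefficient `1` or `2` at `o`. -/
theorem exists_isConnecting_one (hr : 0 < r) (h2 : (2 : k) ≠ 0 ∨ Even r) :
    ∃ x : Fin 1 → Fin r → ℤ, IsConnecting k x := by
  have hsum : ∑ i : Fin r, (-1 : ℤ) ^ ((i : ℕ) + 1) = if Even r then 0 else -1 := by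
    have h := Fin.sum_neg_one_pow ℤ r
    simp only [pow_succ, mul_neg, mul_one, Finset.sum_neg_distrib, h]
    split_ifs <;> simp
  refine ⟨fun _ i => (-1) ^ ((i : ℕ) + 1), Function.injective_of_subsingleton _,
    fun ε => ⟨⟨0, hr⟩, by simp⟩, fun ε => ?_, fun P P' h h' i => ?_⟩
  · rw [hsum]
    split_ifs <;> simp
  · refine (h 0 i (by simp)).1 (h' 0 ?_)
    rw [hsum]
    split_ifs with hev
    · simp
    · have h3 := h2.resolve_right hev
      norm_num
      exact h3

theorem exists_isConnecting_two [CharP k 2] (hr : Odd r) (hr1 : r ≠ 1) :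
    ∃ x : Fin 2 → Fin r → ℤ, IsConnecting k x := by
  obtain ⟨m, rfl⟩ : ∃ m, r = m + 2 := ⟨r - 2, by
    have := hr.pos
    omega⟩
  -- The coefficients at `o` are `1` and `-m`, both odd since `r` is odd. Both weights thus meet `o`
  -- modulo two, and together their supports cover all indices.
  let x : Fin 2 → Fin (m + 2) → ℤ :=
    ![Fin.cons 1 (Fin.cons (-1) 0), Fin.cons 1 (Fin.cons 0 1)]
  have h0 : ∑ i, x 0 i = 0 := by simp [x, Fin.sum_univ_succ]
  have h1 : ∑ i, x 1 i = 1 + m := by simp [x, Fin.sum_univ_succ]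
  have hm : (m : ℤ) ≠ 0 ∧ ((m : ℕ) : k) ≠ 0 := by
    have hodd : ¬ 2 ∣ m := by
      have := Nat.odd_iff.1 hr
      omega
    refine ⟨fun h => hodd ?_, fun h => hodd ((CharP.cast_eq_zero_iff k 2 m).1 h)⟩
    rw [Nat.cast_eq_zero.1 h]
    exact dvd_zero 2
  refine ⟨x, ?_, fun ε => ⟨0, ?_⟩, fun ε => ?_, fun P P' h h' i => ?_⟩
  · intro ε ε' hεε'
    have h3 := congrFun hεε' 1
    fin_cases ε <;> fin_cases ε' <;> simp [x] at h3 ⊢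
  · fin_cases ε <;> simp [x]
  · fin_cases ε
    · simp [h0]
    · simpa [h1] using hm.1
  · have hP0 : P 0 := h' 0 (by simp [h0])
    have hP1 : P 1 := h' 1 (by simpa [h1] using hm.2)
    refine Fin.cases ?_ (fun i => Fin.cases ?_ (fun i => ?_) i) i
    · exact (h 0 0 (by simp [x])).1 hP0
    · exact (h 0 _ (by simp [x])).1 hP0
    · exact (h 1 _ (by simp [x])).1 hP1

end Connecting

end ToricGauss

/-! ### Choice of the parameters and conclusion. -/

open ToricGauss in
theorem theorem5p4 {k : Type*} [Field k] [IsAlgClosed k] (p : ℕ) [CharP k p] (hp : 0 < p)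
    {M' : Type*} [AddCommGroup M'] [Module.Free ℤ M'] [Module.Finite ℤ M']
    (A' : Finset M') (hA' : affineSpan ℤ (A' : Set M') = ⊤)
    (r c : ℕ) (hr : 0 < r) (hc : 0 < c) (hpr : (p, r) ≠ (2, 1)) (hcp : c.Coprime p)
    (n N : ℕ)
    (hn : max ((A'.card - 1) + r) (Module.finrank ℤ M' + r + 1) ≤ n)
    (hN : (if p = 2 ∧ Odd r then 2 * n - Module.finrank ℤ M' - r + 2
      else 2 * n - Module.finrank ℤ M' - r + 1 : ℤ) ≤ N) :
    ∃ A : Finset (Fin n → ℤ),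
      affineSpan ℤ (A : Set (Fin n → ℤ)) = ⊤ ∧ A.card = N + 1 ∧
      ToricGauss.ForGeneralPoint (ToricGauss.toricVariety k A) (fun x =>
        ∀ F ∈ irreducibleComponents (ToricGauss.gaussFiber (ToricGauss.toricVariety k A) x),
          ToricGauss.ProjEquiv (closure (Subtype.val '' F)) (ToricGauss.toricVariety k A')) ∧
      ToricGauss.GaussRankEq (ToricGauss.toricVariety k A) r ∧
      ToricGauss.ForGeneralPoint (ToricGauss.toricVariety k A) (fun x =>
        (irreducibleComponents
          (ToricGauss.gaussFiber (ToricGauss.toricVariety k A) x)).ncard = c) := by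
  classical
  have hprime : Fact p.Prime := ⟨(CharP.char_is_prime_or_zero k p).resolve_right hp.ne'⟩
  -- The number `s` of extra weights, two for `p = 2` and `r` odd and otherwise one, accounts for
  -- the two cases of the bound on `N`.
  obtain ⟨s, x, hx, hs⟩ : ∃ (s : ℕ) (x : Fin s → Fin r → ℤ), IsConnecting k x ∧
      (2 * n - Module.finrank ℤ M' - r + s : ℤ) ≤ N := by
    by_cases hcase : p = 2 ∧ Odd r
    · rw [if_pos hcase] at hN
      obtain ⟨rfl, hodd⟩ := hcase
      obtain ⟨x, hx⟩ := exists_isConnecting_two (k := k) hodd fun h1 => hpr (by rw [h1])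
      exact ⟨2, x, hx, hN⟩
    · rw [if_neg hcase] at hN
      obtain ⟨x, hx⟩ := exists_isConnecting_one (k := k) hr (by
        by_cases h2 : p = 2
        · right
          rw [← Nat.not_odd_iff_even]
          exact fun h => hcase ⟨h2, h⟩
        · left
          intro h0
          have h1 : ((2 : ℕ) : k) = 0 := by exact_mod_cast h0
          rw [CharP.cast_eq_zero_iff k p, Nat.prime_dvd_prime_iff_eq hprime.out Nat.prime_two] at h1
          exact h2 h1)
      exact ⟨1, x, hx, hN⟩
  obtain ⟨hn1, hn2⟩ := max_le_iff.1 hn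
  -- The bounds on `n` say `q ≥ #A'`, which provides `σ`, and `q ≥ rk M' + 2`, which provides two
  -- distinct indices `o`, `l` and a nonzero relation.
  obtain ⟨q, hq⟩ : ∃ q, n + 1 = r + q := ⟨n + 1 - r, by omega⟩
  obtain ⟨t, ht⟩ : ∃ t, N + 1 = (n + 1) + (s + t) := ⟨N - n - s, by omega⟩
  have hAne : A'.Nonempty := by
    by_contra h0
    rw [Finset.not_nonempty_iff_eq_empty] at h0
    rw [h0, Finset.coe_empty, AffineSubspace.span_empty] at hA'
    exact AffineSubspace.bot_ne_top ℤ M' M' hA'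
  have : Nonempty A' := hAne.to_subtype
  obtain ⟨f⟩ : Nonempty (A' ↪ Fin q) := by
    rw [Function.Embedding.nonempty_iff_card_le, Fintype.card_coe, Fintype.card_fin]
    omega
  let σ : Fin q → M' := fun j => (Function.invFun f j : A')
  have hσA : ∀ j, σ j ∈ A' := fun j => (Function.invFun f j).2
  have hσ : ∀ m ∈ A', ∃ j, σ j = m := fun m hm => by
    obtain ⟨j, hj⟩ := Function.invFun_surjective f.injective ⟨m, hm⟩
    exact ⟨j, congrArg Subtype.val hj⟩
  have hrange : Set.range σ = A' := by
    ext m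
    exact ⟨fun ⟨j, hj⟩ => hj ▸ hσA j, fun hm => hσ m hm⟩
  let o : Fin q := ⟨0, by omega⟩
  let l : Fin q := ⟨1, by omega⟩
  have hlo : l ≠ o := by simp [l, o]
  obtain ⟨hrank, hcoord⟩ := exists_coordinate_on_ker (homogenization σ)
    (homogenization_surjective (by rw [hrange, hA']))
  rw [Module.finrank_prod, Module.finrank_self, Module.finrank_fintype_fun_eq_card,
    Fintype.card_fin] at hrank hcoord
  obtain ⟨δ, m, hm, hδm⟩ := hcoord (by omega)
  obtain ⟨μ, hμinj, hμ0, hμ, hspan⟩ := exists_injective_generators (relationLattice σ δ c)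
    (by
      intro h0
      -- The multiple `c • m` of the primitive relation is in the lattice and is nonzero, since `δ`
      -- takes the value `c > 0` on it.
      have h1 : (c : ℤ) • m ∈ relationLattice σ δ c := by
        refine ⟨?_, ?_⟩
        · exact (LinearMap.ker (homogenization σ)).smul_mem _ hm
        · rw [SetLike.mem_coe, Submodule.mem_comap, map_smul, hδm]
          exact Ideal.mem_span_singleton.2 ⟨1, by simp⟩
      rw [h0, Submodule.mem_bot] at h1
      have h2 := congrArg δ h1
      rw [map_smul, hδm, map_zero, smul_eq_mul, mul_one] at h2
      omega) (t := t)
    -- The kernel has rank `q - 1 - rk M' = n - r - rk M'`, and the bound on `N` says precisely that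
    -- `t = N - n - s` is at least this.
    ((Submodule.finrank_mono (inf_le_left : relationLattice σ δ c ≤
      LinearMap.ker (homogenization σ))).trans (by omega))
  have hμsum : ∀ j, ∑ i, μ j i = 0 := fun j => (mem_relationLattice.1 (hμ j)).1.1
  have : Nonempty ((Fin r ⊕ Fin q) ⊕ Fin s ⊕ Fin t) := ⟨Sum.inl (Sum.inr o)⟩
  have hF := isFiberFrame_toricWeights (p := p) (o := o) (l := l) hx hμ hspan ⟨m, hm, hδm⟩
  have hσ1 : ∀ j, LinearMap.snd ℤ ℤ M' (homogenization σ (Pi.single j 1)) = σ j := fun j => by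
    simp [homogenization, Pi.single_apply]
  refine exists_toricVariety A' hc hcp (toricWeights_injective hx hlo hprime.out.one_lt hμinj hμ0)
    (isAffineFrame_toricWeights hμsum) hF ?_ ?_ ?_ ?_ ?_
  · have hbase : ∀ i : Fin r ⊕ Fin q, LinearMap.snd ℤ ℤ M'
        (homogenization σ (collapse o (Pi.single i 1))) ∈ A' := by
      rintro (i | j)
      · rw [collapse_single_inl, hσ1]
        exact hσA o
      · rw [collapse_single_inr, hσ1]
        exact hσA j
    have hedge : ∀ u i, (toricWeights p o l x μ u i : k) ≠ 0 →
        LinearMap.snd ℤ ℤ M' (homogenization σ (collapse o (toricWeights p o l x μ u))) ∈ A' := by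
      intro u i hui
      have h1 := hF.map_edge u i hui
      simp only [LinearMap.toAddMonoidHom_coe, LinearMap.comp_apply] at h1
      rw [h1]
      exact hbase i
    rintro (i | ε | j)
    · exact hbase i
    · simp only [LinearMap.toAddMonoidHom_coe, LinearMap.comp_apply]
      have h1 : collapse o (toricWeights p o l x μ (Sum.inr (Sum.inl ε))) = Pi.single o 1 :=
        collapse_extraWeight o (x ε)
      rw [h1, hσ1]
      exact hσA o
    · exact hedge _ _ (toricWeights_fat_ne_zero j)
  · intro m hm
    obtain ⟨j, rfl⟩ := hσ m hm
    refine ⟨Sum.inl (Sum.inr j), ?_⟩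
    simp only [LinearMap.toAddMonoidHom_coe, LinearMap.comp_apply]
    have h1 : collapse o (toricWeights p o l x μ (Sum.inl (Sum.inr j))) = Pi.single j 1 :=
      collapse_single_inr o j
    rw [h1, hσ1]
  · rw [finrank_edgeInvariantSubmodule_toricWeights hx hμsum]
    simp [add_comm]
  · simp [hq]
  · simp [ht, hq]
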